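/- **Time complexity of Inkheart SGD.** *Problem.* Let $n,d\ge 1$, and let $f:\mathbb R^d\to\mathbb R$ be differentiable and such that: $\|\nabla f(x)-\nabla f(y)\|\le L\|x-y\|$ for all $x,y$; $f(x)\ge f^*$ for all $x$; and, for constants $L_A,L_B\ge 0$, $$\Big\|\tfrac1N\sum_{i=1}^N(\nabla f(x+u_i)-\nabla f(x))\Big\|^2\le L_A^2\,\tfrac1N\sum_{i=1}^N\|u_i\|^2+L_B^2\Big\|\tfrac1N\sum_{i=1}^N u_i\Big\|^2$$ for all $N\ge1$ and $x,u_1,\dots,u_N\in\mathbb R^d$. Put $\Delta=f(x^0)-f^*$, where $x^0$ is the starting point, and $L_{\max}=\max\{L,L_A,L_B\}$. The workers have access to stochastic gradients $\nabla f(x;\xi)$, $\xi\sim\mathcal D$, with $\mathbb E_\xi\nabla f(x;\xi)=\nabla f(x)$ and $\mathbb E_\xi\|\nabla f(x;\xi)-\nabla f(x)\|^2\le\sigma^2$ for all $x$. Let $\varepsilon>0$. *Method.* Inkheart SGD with $n$ workers starts with $x_i^0=x^0$ for all $i$ and iterates $$g^k=\frac1n\sum_{i=1}^n\frac1{bm}\sum_{j=1}^m\mathcal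 C_{ij}^k\Big(\sum_{r=1}^b\nabla f(x_i^k;\xi_{ir}^k)\Big),\qquad x^{k+1}=x^k-\gamma g^k,\qquad c^k\sim\mathrm{Bernoulli}(p),$$ $$x_i^{k+1}=x^{k+1}\ \text{ if } c^k=1,\qquad x_i^{k+1}=x_i^k+\frac1\ell\sum_{j=1}^\ell\mathcal C_{\mathrm s,ij}^k(x^{k+1}-x^k)\ \text{ if } c^k=0 .$$ All $\mathcal C_{ij}^k$ and $\mathcal C_{\mathrm s,ij}^k$ are Rand$1$ compressors, $v\mapsto d\,v_Je_J$ with $J$ uniform on $\{1,\dots,d\}$; the samples $\xi_{ir}^k\sim\mathcal D$, the coordinates drawn by the compressors and the coins $c^k$ (one coin per iteration, common to all workers) are mutually independent. *Time.* Let $h,\tau,\kappa>0$. A worker computes a stochastic gradient in at most $h$ seconds; sending takes at most $\tau$ seconds per coordinate from a worker to the server and at most $\kappa$ seconds per coordinate from the server to a worker (one coordinate for a Rand$1$-compressed vector, $d$ coordinates for a full vector). In each iteration the workers, in parallel, compute their $b$ stochastic gradients and send their $m$ compressed vectors; after all have arrived, the server sends to all workers, in parallel, the full vector $x^{k+1}$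 if $c^k=1$ and $\ell$ compressed vectors to each worker if $c^k=0$. *Parameters.* With $\omega=\omega_{\mathrm s}=d-1$ let $$t=\max\Big\{h,\tau,\kappa,\tfrac{16\omega\tau}{n},\tfrac{16\sigma^2h}{n\varepsilon},\tfrac{2d\kappa}{\sqrt n},\sqrt{\tfrac{32d\sigma^2h\tau}{n\varepsilon}},\big(\tfrac{8d^3\tau\kappa^2}{n}\big)^{1/3}\Big\},$$ $b=\lfloor t/h\rfloor$, $m=\lfloor t/\tau\rfloor$, $\ell=\lfloor t/\kappa\rfloor$, $p=\min\{\ell/d,1\}$ and $$M=\max\Big\{L_{\max},\tfrac{\sqrt{\omega\omega_{\mathrm s}}L_{\max}}{\sqrt{pnm\ell}},\tfrac{\sqrt{\omega_{\mathrm s}}L_{\max}}{\sqrt{p\ell n}},\tfrac{\sqrt{\omega_{\mathrm s}}L_A}{\sqrt{p\ell}}\Big\}.$$ *Claim.* For every $c>0$ there is a constant $C>0$, depending on $c$ only, such that the following holds for every step size $\gamma>0$ with $c\le\gamma M\le\frac16$ (that is, $\gamma=\Theta(1/M)$). There is a deterministic number $N\ge 0$ of iterations, depending only on the numbers $n,d,h,\tau,\kappa,\sigma,\varepsilon,L,L_A,L_B,\Delta,\gamma$,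 such that, for every problem as above and all operation times as above (possibly random), the point $\bar x$ drawn uniformly from $x^0,\dots,x^N$ (independently of the run) is $\varepsilon$-stationary, i.e. $\mathbb E\|\nabla f(\bar x)\|^2\le\varepsilon$, and the expected time of these $N$ iterations is at most $$C\left(\max\Big\{h,\tau,\kappa,\tfrac{d\kappa}{\sqrt n},\tfrac{d\tau}{n},\big(\tfrac{d^3\tau\kappa^2}{n}\big)^{1/3},\sqrt{\tfrac{d\sigma^2h\tau}{n\varepsilon}},\tfrac{\sigma^2h}{n\varepsilon}\Big\}\frac{L_{\max}\Delta}{\varepsilon}+\frac{d\kappa L_A\Delta}{\varepsilon}\right).$$ -/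

import Mathlib

open MeasureTheory ProbabilityTheory

universe u v

noncomputable section

namespace Inkheart

/-- The space `ℝ^d` with the Euclidean norm. -/
abbrev Vec (d : ℕ) : Type := EuclideanSpace ℝ (Fin d)

/-- `f` is differentiable with `L`-Lipschitz gradient. -/
def IsLSmooth {d : ℕ} (f : Vec d → ℝ) (L : ℝ) : Prop :=
  Differentiable ℝ f ∧ ∀ x y : Vec d, ‖gradient f x - gradient f y‖ ≤ L * ‖x - y‖

/-- The functional `(L_A, L_B)` inequality. The number `N` of shifts is arbitrary, it is not tied
to the number of workers. -/
def FunctionalInequality {d : ℕ} (f : Vec d → ℝ) (LA LB : ℝ) : Prop :=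
  0 ≤ LA ∧ 0 ≤ LB ∧
    ∀ N : ℕ, 1 ≤ N → ∀ (x : Vec d) (u : Fin N → Vec d),
      ‖(N : ℝ)⁻¹ • ∑ i, (gradient f (x + u i) - gradient f x)‖ ^ 2 ≤
        LA ^ 2 * ((N : ℝ)⁻¹ * ∑ i, ‖u i‖ ^ 2) + LB ^ 2 * ‖(N : ℝ)⁻¹ • ∑ i, u i‖ ^ 2

/-- `G x ξ`, with `ξ` of law `D`, is an unbiased stochastic gradient of `f` at `x` with variance at
most `σ²`. -/
structure IsStochasticGradient {d : ℕ} {Ξ : Type u} [MeasurableSpace Ξ]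
    (f : Vec d → ℝ) (G : Vec d → Ξ → Vec d) (D : Measure Ξ) (σ : ℝ) : Prop where
  measurable : Measurable (Function.uncurry G)
  integrable : ∀ x, Integrable (G x) D
  unbiased : ∀ x, ∫ ξ, G x ξ ∂D = gradient f x
  sq_integrable : ∀ x, Integrable (fun ξ => ‖G x ξ - gradient f x‖ ^ 2) D
  variance_le : ∀ x, ∫ ξ, ‖G x ξ - gradient f x‖ ^ 2 ∂D ≤ σ ^ 2

/-- The Rand1 compressor: keep coordinate `j` (drawn uniformly), multiplied by `d`. -/
def rand1 {d : ℕ} (j : Fin d) (v : Vec d) : Vec d :=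
  EuclideanSpace.single j ((d : ℝ) * v j)

/-- The uniform distribution on `{0, …, d - 1}`. -/
def uniformFin (d : ℕ) [NeZero d] : Measure (Fin d) :=
  (PMF.uniformOfFintype (Fin d)).toMeasure

/-- The Bernoulli distribution with parameter `p` (for `p ∈ [0, 1]`), on `Bool`. -/
def bernoulliBool (p : ℝ) : Measure Bool :=
  ENNReal.ofReal p • Measure.dirac true + ENNReal.ofReal (1 - p) • Measure.dirac false

/-- Labels of the elementary random draws of the method. -/
inductive Seed (n b m l : ℕ) : Type
  | sample (k : ℕ) (i : Fin n) (r : Fin b) : Seed n b m l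
  | upIdx (k : ℕ) (i : Fin n) (j : Fin m) : Seed n b m l
  | coin (k : ℕ) : Seed n b m l
  | downIdx (k : ℕ) (i : Fin n) (j : Fin l) : Seed n b m l

/-- All random draws of a run of the method with `n` workers in `ℝ^d`, batch size `b`, `m` uplink
and `l` downlink Rand1 compressors per worker and synchronization probability `p`: the samples
`ξ_{ir}^k`, the coordinates selected by the compressors `C_{ij}^k` and `C_{s,ij}^k`, and the
coins `c^k`; they have the prescribed laws and are mutually independent. -/
structure Randomness {Ω : Type v} [MeasurableSpace Ω] (P : Measure Ω)
    {Ξ : Type u} [MeasurableSpace Ξ] (D : Measure Ξ)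
    (n d b m l : ℕ) [NeZero d] (p : ℝ) where
  sample : ℕ → Fin n → Fin b → Ω → Ξ
  upIdx : ℕ → Fin n → Fin m → Ω → Fin d
  coin : ℕ → Ω → Bool
  downIdx : ℕ → Fin n → Fin l → Ω → Fin d
  measurable_sample : ∀ k i r, Measurable (sample k i r)
  measurable_upIdx : ∀ k i j, Measurable (upIdx k i j)
  measurable_coin : ∀ k, Measurable (coin k)
  measurable_downIdx : ∀ k i j, Measurable (downIdx k i j)
  law_sample : ∀ k i r, P.map (sample k i r) = D
  law_upIdx : ∀ k i j, P.map (upIdx k i j) = uniformFin d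
  law_coin : ∀ k, P.map (coin k) = bernoulliBool p
  law_downIdx : ∀ k i j, P.map (downIdx k i j) = uniformFin d
  indep : iIndep (fun s : Seed n b m l =>
    match s with
    | .sample k i r => MeasurableSpace.comap (sample k i r) inferInstance
    | .upIdx k i j => MeasurableSpace.comap (upIdx k i j) inferInstance
    | .coin k => MeasurableSpace.comap (coin k) inferInstance
    | .downIdx k i j => MeasurableSpace.comap (downIdx k i j) inferInstance) P

section Method

variable {Ω : Type v} [MeasurableSpace Ω] {P : Measure Ω} {Ξ : Type u} [MeasurableSpace Ξ]
  {D : Measure Ξ} {n d b m l : ℕ} [NeZero d] {p : ℝ}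

/-- The aggregated gradient estimator `g^k`, when the local points of the workers are `xs`. -/
def gradEstimate (R : Randomness P D n d b m l p) (G : Vec d → Ξ → Vec d) (k : ℕ) (ω : Ω)
    (xs : Fin n → Vec d) : Vec d :=
  (n : ℝ)⁻¹ • ∑ i, ((b : ℝ) * (m : ℝ))⁻¹ •
    ∑ j, rand1 (R.upIdx k i j ω) (∑ r, G (xs i) (R.sample k i r ω))

/-- The state `(x^k, (x_i^k)_i)` of Inkheart SGD with step size `γ`, started at `x0`. -/
def state (R : Randomness P D n d b m l p) (G : Vec d → Ξ → Vec d) (γ : ℝ) (x0 : Vec d)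
    (ω : Ω) : ℕ → Vec d × (Fin n → Vec d)
  | 0 => (x0, fun _ => x0)
  | k + 1 =>
    let s := state R G γ x0 ω k
    let y := s.1 - γ • gradEstimate R G k ω s.2
    (y, fun i =>
      if R.coin k ω = true then y
      else s.2 i + (l : ℝ)⁻¹ • ∑ j, rand1 (R.downIdx k i j ω) (y - s.1))

/-- After `N` iterations, return one of `x^0, …, x^N`, the index being a fresh draw. -/
def output (R : Randomness P D n d b m l p) (G : Vec d → Ξ → Vec d) (γ : ℝ) (x0 : Vec d)
    (N : ℕ) (z : Ω × Fin (N + 1)) : Vec d :=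
  (state R G γ x0 z.1 z.2).1

/-- The (possibly random) durations of all operations of a run, in seconds: a stochastic gradient
takes at most `h`, and sending takes at most `τ` per coordinate from a worker to the
server and at most `κ` per coordinate from the server to a worker. A Rand1-compressed vector is one
coordinate, a full vector is `d` coordinates. -/
structure Timing (Ω : Type v) [MeasurableSpace Ω] (n d b m l : ℕ) (h τ κ : ℝ) where
  compute : ℕ → Fin n → Fin b → Ω → ℝ
  upload : ℕ → Fin n → Fin m → Ω → ℝ
  download : ℕ → Fin n → Fin l → Ω → ℝ
  sync : ℕ → Fin n → Ω → ℝ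
  measurable_compute : ∀ k i r, Measurable (compute k i r)
  measurable_upload : ∀ k i j, Measurable (upload k i j)
  measurable_download : ∀ k i j, Measurable (download k i j)
  measurable_sync : ∀ k i, Measurable (sync k i)
  compute_mem : ∀ k i r ω, compute k i r ω ∈ Set.Icc 0 h
  upload_mem : ∀ k i j ω, upload k i j ω ∈ Set.Icc 0 τ
  download_mem : ∀ k i j ω, download k i j ω ∈ Set.Icc 0 κ
  sync_mem : ∀ k i ω, sync k i ω ∈ Set.Icc 0 ((d : ℝ) * κ)

/-- Duration of iteration `k`: the workers, in parallel, compute `b` stochastic gradients and send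
`m` compressed vectors; when all have arrived, the server sends, in parallel to all workers, the
full new point (if the coin shows `1`) or `l` compressed vectors (otherwise). -/
def iterationTime {h τ κ : ℝ} (R : Randomness P D n d b m l p) (T : Timing Ω n d b m l h τ κ)
    (k : ℕ) (ω : Ω) : ℝ :=
  (⨆ i, (∑ r, T.compute k i r ω + ∑ j, T.upload k i j ω)) +
    ⨆ i, (if R.coin k ω = true then T.sync k i ω else ∑ j, T.download k i j ω)

/-- Duration of the first `N` iterations. -/
def totalTime {h τ κ : ℝ} (R : Randomness P D n d b m l p) (T : Timing Ω n d b m l h τ κ)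
    (N : ℕ) (ω : Ω) : ℝ :=
  ∑ k ∈ Finset.range N, iterationTime R T k ω

end Method

/-- The random point `X` is an `ε`-stationary point of `f`: `E ‖∇f(X)‖² ≤ ε`. -/
def IsEpsStationary {d : ℕ} {Ω : Type v} [MeasurableSpace Ω] (P : Measure Ω)
    (f : Vec d → ℝ) (ε : ℝ) (X : Ω → Vec d) : Prop :=
  Measurable X ∧ Integrable (fun ω => ‖gradient f (X ω)‖ ^ 2) P ∧
    ∫ ω, ‖gradient f (X ω)‖ ^ 2 ∂P ≤ ε

/-- `L_max = max {L, L_A, L_B}`. -/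
def lMax (L LA LB : ℝ) : ℝ := L ⊔ LA ⊔ LB

/-- The variance parameter `ω = d - 1` of Rand1. -/
def rand1Omega (d : ℕ) : ℝ := (d : ℝ) - 1

/-- The time budget `t`. -/
def timeBudget (n d : ℕ) (h τ κ σ ε : ℝ) : ℝ :=
  h ⊔ τ ⊔ κ ⊔ (16 * rand1Omega d * τ / n) ⊔ (16 * σ ^ 2 * h / (n * ε)) ⊔ (2 * d * κ / √(n : ℝ)) ⊔
    √(32 * d * σ ^ 2 * h * τ / (n * ε)) ⊔ (8 * d ^ 3 * τ * κ ^ 2 / n) ^ (1 / 3 : ℝ)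

/-- The quantity `M` such that the step size is of order `1 / M` (with `ω = ω_s = d - 1`). -/
def stepScale (n d m l : ℕ) (p L LA LB : ℝ) : ℝ :=
  lMax L LA LB ⊔
    (√(rand1Omega d * rand1Omega d) * lMax L LA LB / √(p * n * m * l)) ⊔
    (√(rand1Omega d) * lMax L LA LB / √(p * l * n)) ⊔
    (√(rand1Omega d) * LA / √(p * l))

/-- The time complexity. -/
def timeRate (n d : ℕ) (h τ κ σ ε L LA LB Δ : ℝ) : ℝ :=
  (h ⊔ τ ⊔ κ ⊔ (d * κ / √(n : ℝ)) ⊔ (d * τ / n) ⊔ (d ^ 3 * τ * κ ^ 2 / n) ^ (1 / 3 : ℝ) ⊔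
      √(d * σ ^ 2 * h * τ / (n * ε)) ⊔ (σ ^ 2 * h / (n * ε))) * (lMax L LA LB * Δ / ε) +
    d * κ * LA * Δ / ε

end Inkheart

end

noncomputable section

set_option linter.unusedSectionVars false

namespace Inkheart

/-! ### Smooth functions -/

/-! The proof is a Lyapunov argument for `lyapunov`, that is Φ = f(x) - f* + α V + β W, where V is
the mean of ‖x_i - x‖² and W the squared norm of the mean of x_i - x; these are the two quantities
in the functional inequality. An average of N Rand1 compressors multiplies each coordinate by a
random factor of mean 1 and variance ω/N. All moments are therefore computed coordinate by
coordinate from independent scalars. This gives the second moment of g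
(`integral_norm_gradOf_sq_le`) and the exact one-step recursions of V and W (`displacement_worker`,
`displacement_mean`): both contract by 1 - p, and W receives n times less noise than V. With the
descent lemma and the polarization of ⟨∇f(x), E g⟩ this yields `one_step`: E Φ⁺ + (67/144) γ
‖∇f(x)‖² ≤ Φ + (5/144) γ ε. Here M controls the coefficient of E‖g‖², and the sizes of b and m
control the gradient noise. Telescoping makes the output ε-stationary once 4Δ ≤ (N + 1) γ ε
(`isEpsStationary_of_le`). An iteration takes at most 4t in expectation, and N is of order MΔ/ε, so
the cost is governed by t M. The budget t is chosen so that the two terms of M containing n are at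
most L_max, while t times the last term is at most 2 d κ L_A or t L_max (`budget_mul_stepScale_le`).
If 2 L_max Δ ≤ ε, then x⁰ is already stationary and N = 0 suffices. -/

theorem IsLSmooth.mono {d : ℕ} {f : Vec d → ℝ} {L L' : ℝ} (hf : IsLSmooth f L) (h : L ≤ L') :
    IsLSmooth f L' :=
  ⟨hf.1, fun x y => (hf.2 x y).trans (by gcongr)⟩

theorem IsLSmooth.nonneg {d : ℕ} [NeZero d] {f : Vec d → ℝ} {L : ℝ} (hf : IsLSmooth f L) :
    0 ≤ L := by
  have h := (norm_nonneg _).trans (hf.2 (EuclideanSpace.single 0 1) 0)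
  simpa using h

theorem IsLSmooth.continuous_gradient {d : ℕ} {f : Vec d → ℝ} {L : ℝ} (hf : IsLSmooth f L) :
    Continuous (gradient f) := by
  have h : LipschitzWith (L.toNNReal) (gradient f) := by
    refine LipschitzWith.of_dist_le_mul fun x y => ?_
    rw [dist_eq_norm, dist_eq_norm]
    refine (hf.2 x y).trans ?_
    gcongr
    exact Real.le_coe_toNNReal L
  exact h.continuous

/-- The descent lemma. -/
theorem IsLSmooth.le_quadratic {d : ℕ} {f : Vec d → ℝ} {L : ℝ} (hf : IsLSmooth f L)
    (x v : Vec d) :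
    f (x + v) ≤ f x + inner ℝ (gradient f x) v + L / 2 * ‖v‖ ^ 2 := by
  -- On [0, 1] the derivative of ψ is at most 0 by Cauchy–Schwarz and the Lipschitz bound; the claim
  -- is ψ 1 ≤ ψ 0.
  set ψ : ℝ → ℝ := fun t => f (x + t • v) - t * inner ℝ (gradient f x) v - L / 2 * ‖v‖ ^ 2 * t ^ 2
  have hψ : ∀ t, HasDerivAt ψ (inner ℝ (gradient f (x + t • v)) v - inner ℝ (gradient f x) v
      - L * ‖v‖ ^ 2 * t) t := by
    intro t
    have h1 : HasDerivAt (fun t : ℝ => x + t • v) v t := by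
      simpa using ((hasDerivAt_id t).smul_const v).const_add x
    have h2 : HasDerivAt (fun t : ℝ => f (x + t • v)) (inner ℝ (gradient f (x + t • v)) v) t := by
      have h3 := (hf.1 (x + t • v)).hasFDerivAt.comp_hasDerivAt t h1
      rw [← inner_gradient_left] at h3
      exact h3
    have h4 := ((h2.sub ((hasDerivAt_id t).mul_const (inner ℝ (gradient f x) v))).sub
      (((hasDerivAt_id t).pow 2).const_mul (L / 2 * ‖v‖ ^ 2)))
    refine h4.congr_deriv ?_
    simp
    ring
  have hanti : AntitoneOn ψ (Set.Icc 0 1) := by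
    refine antitoneOn_of_deriv_nonpos (convex_Icc 0 1)
      (fun t _ => (hψ t).continuousAt.continuousWithinAt)
      (fun t _ => (hψ t).differentiableAt.differentiableWithinAt) fun t ht => ?_
    rw [interior_Icc] at ht
    rw [(hψ t).deriv, ← inner_sub_left]
    have h1 := real_inner_le_norm (gradient f (x + t • v) - gradient f x) v
    have h2 := hf.2 (x + t • v) x
    rw [add_sub_cancel_left, norm_smul, Real.norm_of_nonneg ht.1.le] at h2
    have h3 := mul_le_mul_of_nonneg_right h2 (norm_nonneg v)
    nlinarith
  have h := hanti (Set.left_mem_Icc.2 zero_le_one) (Set.right_mem_Icc.2 zero_le_one) zero_le_one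
  simp only [ψ, one_smul, zero_smul, add_zero] at h
  linarith

/-- The descent lemma for the gradient step of length 1/L, whose endpoint still has value at least
f*. It settles the case where no iteration is needed. -/
theorem IsLSmooth.norm_gradient_sq_le {d : ℕ} {f : Vec d → ℝ} {L fstar : ℝ} (hL : 0 < L)
    (hf : IsLSmooth f L) (hstar : ∀ x, fstar ≤ f x) (x : Vec d) :
    ‖gradient f x‖ ^ 2 ≤ 2 * L * (f x - fstar) := by
  have h1 := hf.le_quadratic x (-L⁻¹ • gradient f x)
  have h2 := hstar (x + -L⁻¹ • gradient f x)
  rw [real_inner_smul_right, real_inner_self_eq_norm_sq, norm_smul, mul_pow, norm_neg,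
    Real.norm_of_nonneg (inv_nonneg.2 hL.le)] at h1
  have h3 : L / 2 * (L⁻¹ ^ 2 * ‖gradient f x‖ ^ 2) = L⁻¹ / 2 * ‖gradient f x‖ ^ 2 := by
    field_simp
  have h4 : L⁻¹ / 2 * ‖gradient f x‖ ^ 2 ≤ f x - fstar := by nlinarith
  calc ‖gradient f x‖ ^ 2 = 2 * L * (L⁻¹ / 2 * ‖gradient f x‖ ^ 2) := by field_simp
    _ ≤ _ := by gcongr

/-! ### Moments of independent random variables -/

section Moments

variable {Ω : Type v} [MeasurableSpace Ω] {P : Measure Ω}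

/-- Fubini for a product law: the state may be frozen while the fresh draws are averaged. With
values in `ENNReal`, no integrability along the trajectory has to be known. -/
theorem lintegral_indepFun [IsProbabilityMeasure P] {α β : Type*} [MeasurableSpace α] [MeasurableSpace β] {X : Ω → α}
    {Y : Ω → β} (hX : Measurable X) (hY : Measurable Y) (h : IndepFun X Y P)
    {F : α → β → ENNReal} (hF : Measurable (Function.uncurry F)) :
    ∫⁻ ω, F (X ω) (Y ω) ∂P = ∫⁻ ω, ∫⁻ ω', F (X ω) (Y ω') ∂P ∂P := by
  have hmap := (indepFun_iff_map_prod_eq_prod_map_map hX.aemeasurable hY.aemeasurable).1 h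
  have := Measure.isProbabilityMeasure_map (μ := P) hY.aemeasurable
  calc ∫⁻ ω, F (X ω) (Y ω) ∂P
      = ∫⁻ z, Function.uncurry F z ∂(P.map fun ω => (X ω, Y ω)) :=
        (lintegral_map hF (hX.prodMk hY)).symm
    _ = ∫⁻ x, ∫⁻ y, F x y ∂(P.map Y) ∂(P.map X) := by
        rw [hmap, lintegral_prod _ hF.aemeasurable]; rfl
    _ = ∫⁻ ω, ∫⁻ y, F (X ω) y ∂(P.map Y) ∂P :=
        lintegral_map hF.lintegral_prod_right' hX
    _ = _ := by
        refine lintegral_congr fun ω => lintegral_map ?_ hY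
        exact hF.comp measurable_prodMk_left

theorem integral_sq_eq_variance_add [IsProbabilityMeasure P] {X : Ω → ℝ} (hX : MemLp X 2 P) :
    ∫ ω, X ω ^ 2 ∂P = Var[X; P] + (∫ ω, X ω ∂P) ^ 2 := by
  rw [variance_eq_sub hX]
  simp

theorem memLp_mean {N : ℕ} {X : Fin N → Ω → ℝ} (hX : ∀ i, MemLp (X i) 2 P) :
    MemLp (fun ω => (N : ℝ)⁻¹ * ∑ i, X i ω) 2 P :=
  (memLp_finsetSum _ fun i _ => hX i).const_mul _

theorem integral_mean [IsProbabilityMeasure P] {N : ℕ} {X : Fin N → Ω → ℝ} (hX : ∀ i, MemLp (X i) 2 P) :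
    ∫ ω, (N : ℝ)⁻¹ * ∑ i, X i ω ∂P = (N : ℝ)⁻¹ * ∑ i, ∫ ω, X i ω ∂P := by
  rw [integral_const_mul, integral_finsetSum _ fun i _ => (hX i).integrable one_le_two]

theorem variance_mean {N : ℕ} {X : Fin N → Ω → ℝ} (hX : ∀ i, MemLp (X i) 2 P)
    (hind : Pairwise fun i j => IndepFun (X i) (X j) P) :
    Var[fun ω => (N : ℝ)⁻¹ * ∑ i, X i ω; P] = ((N : ℝ)⁻¹) ^ 2 * ∑ i, Var[X i; P] := by
  rw [variance_const_mul, ← IndepFun.variance_sum (fun i _ => hX i) fun i _ j _ hij => hind hij]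
  congr 2
  ext ω
  simp

theorem memLp_mul_of_indepFun {S T : Ω → ℝ} (hS : MemLp S 2 P) (hT : MemLp T 2 P)
    (h : IndepFun S T P) : MemLp (fun ω => S ω * T ω) 2 P := by
  refine (memLp_two_iff_integrable_sq
    (hS.aestronglyMeasurable.mul hT.aestronglyMeasurable)).2 ?_
  simp only [Pi.mul_apply, mul_pow]
  exact IndepFun.integrable_mul (h.comp (measurable_id.pow_const 2) (measurable_id.pow_const 2))
    hS.integrable_sq hT.integrable_sq

theorem integral_sq_mul_of_indepFun {S T : Ω → ℝ} (hS : MemLp S 2 P) (hT : MemLp T 2 P)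
    (h : IndepFun S T P) :
    ∫ ω, (S ω * T ω) ^ 2 ∂P = (∫ ω, S ω ^ 2 ∂P) * ∫ ω, T ω ^ 2 ∂P := by
  simp only [mul_pow]
  exact IndepFun.integral_mul_eq_mul_integral
    (h.comp (measurable_id.pow_const 2) (measurable_id.pow_const 2))
    hS.integrable_sq.aestronglyMeasurable hT.integrable_sq.aestronglyMeasurable

theorem integral_mul_of_indepFun {S T : Ω → ℝ} (hS : MemLp S 2 P) (hT : MemLp T 2 P)
    (h : IndepFun S T P) :
    ∫ ω, S ω * T ω ∂P = (∫ ω, S ω ∂P) * ∫ ω, T ω ∂P :=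
  IndepFun.integral_mul_eq_mul_integral h hS.aestronglyMeasurable hT.aestronglyMeasurable

/-- The second moment of a constant displaced by a multiple `(T - 1) δ` of an independent
variable `δ`, and then killed by an independent factor `κ`. -/
theorem displaced_moment [IsProbabilityMeasure P] {κ T δ : Ω → ℝ} (hκ : MemLp κ 2 P) (hT : MemLp T 2 P)
    (hδ : MemLp δ 2 P) (hTδ : IndepFun T δ P)
    (u : ℝ) (hκTδ : IndepFun κ (fun ω => u + (T ω - 1) * δ ω) P) (hT1 : ∫ ω, T ω ∂P = 1) :
    MemLp (fun ω => κ ω * (u + (T ω - 1) * δ ω)) 2 P ∧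
      ∫ ω, (κ ω * (u + (T ω - 1) * δ ω)) ^ 2 ∂P =
        (∫ ω, κ ω ^ 2 ∂P) * (u ^ 2 + Var[T; P] * ∫ ω, δ ω ^ 2 ∂P) := by
  have hT' : MemLp (fun ω => T ω - 1) 2 P := hT.sub (memLp_const 1)
  have hind : IndepFun (fun ω => T ω - 1) δ P :=
    hTδ.comp (φ := fun x => x - 1) (ψ := id) (by fun_prop) measurable_id
  have hm0 : ∫ ω, (T ω - 1) ∂P = 0 := by
    rw [integral_sub (hT.integrable one_le_two) (integrable_const _), hT1]
    simp
  have hv : ∫ ω, (T ω - 1) ^ 2 ∂P = Var[T; P] := by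
    rw [variance_eq_integral hT.aestronglyMeasurable.aemeasurable, hT1]
  have hp : MemLp (fun ω => (T ω - 1) * δ ω) 2 P := memLp_mul_of_indepFun hT' hδ hind
  have hq : MemLp (fun ω => u + (T ω - 1) * δ ω) 2 P := (memLp_const u).add hp
  refine ⟨memLp_mul_of_indepFun hκ hq hκTδ, ?_⟩
  rw [integral_sq_mul_of_indepFun hκ hq hκTδ]
  congr 1
  -- The cross term integrates to 0 because T - 1 is centred and independent of δ, whatever the mean
  -- of δ is.
  have h1 : ∀ ω, (u + (T ω - 1) * δ ω) ^ 2 =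
      u ^ 2 + (2 * u * ((T ω - 1) * δ ω) + ((T ω - 1) * δ ω) ^ 2) := fun ω => by ring
  simp only [h1]
  have hi := (hp.integrable one_le_two).const_mul (2 * u)
  rw [integral_add (g := fun ω => 2 * u * ((T ω - 1) * δ ω) + ((T ω - 1) * δ ω) ^ 2)
    (integrable_const _) (hi.add hp.integrable_sq), integral_add hi hp.integrable_sq,
    integral_const_mul, integral_mul_of_indepFun hT' hδ hind, hm0,
    integral_sq_mul_of_indepFun hT' hδ hind, hv]
  simp

end Moments

/-! ### Averages of Rand1 compressors -/

/-- The factor by which the average of the compressors with indices `J j` multiplies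
coordinate `a`. -/
def rand1Factor {d N : ℕ} (J : Fin N → Fin d) (a : Fin d) : ℝ :=
  (N : ℝ)⁻¹ * ∑ j, if J j = a then (d : ℝ) else 0

/-- Rand1 acts diagonally, so vector statements about compressors reduce to scalar factors, one per
coordinate. -/
theorem mean_rand1_apply {d N : ℕ} (J : Fin N → Fin d) (v : Vec d) (a : Fin d) :
    ((N : ℝ)⁻¹ • ∑ j, rand1 (J j) v) a = rand1Factor J a * v a := by
  simp only [rand1, PiLp.smul_apply, smul_eq_mul, rand1Factor, mul_assoc, Finset.sum_mul,
    WithLp.ofLp_sum, Finset.sum_apply]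
  congr 1
  refine Finset.sum_congr rfl fun j _ => ?_
  by_cases h : J j = a
  · subst h; simp
  · simp [h, Ne.symm h]

theorem uniformFin_singleton (d : ℕ) [NeZero d] (a : Fin d) :
    uniformFin d {a} = (d : ENNReal)⁻¹ := by
  simp [uniformFin]

instance (d : ℕ) [NeZero d] : IsProbabilityMeasure (uniformFin d) := by
  unfold uniformFin; infer_instance

theorem integral_uniformFin {d : ℕ} [NeZero d] (F : Fin d → ℝ) :
    ∫ a, F a ∂(uniformFin d) = (d : ℝ)⁻¹ * ∑ a, F a := by
  rw [integral_fintype .of_finite, Finset.mul_sum]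
  simp [measureReal_def, uniformFin_singleton]

section Factor

variable {Ω : Type v} [MeasurableSpace Ω] {P : Measure Ω} [IsProbabilityMeasure P] {d N : ℕ}
  {J : Fin N → Ω → Fin d}

theorem memLp_of_fintype {α : Type*} [Finite α] [MeasurableSpace α] [MeasurableSingletonClass α]
    {X : Ω → α} (hX : Measurable X) (F : α → ℝ) : MemLp (fun ω => F (X ω)) 2 P := by
  obtain ⟨C, hC⟩ := Set.finite_range (fun a => ‖F a‖) |>.bddAbove
  refine MemLp.of_bound ((measurable_of_countable F).comp hX).aestronglyMeasurable C
    (ae_of_all _ fun ω => hC ⟨X ω, rfl⟩)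

theorem memLp_rand1Factor (hJ : ∀ j, Measurable (J j)) (a : Fin d) :
    MemLp (fun ω => rand1Factor (fun j => J j ω) a) 2 P :=
  memLp_mean fun j => memLp_of_fintype (hJ j) fun b => if b = a then (d : ℝ) else 0

theorem integral_rand1Factor [NeZero d] (hN : N ≠ 0) (hJ : ∀ j, Measurable (J j))
    (hlaw : ∀ j, P.map (J j) = uniformFin d) (a : Fin d) :
    ∫ ω, rand1Factor (fun j => J j ω) a ∂P = 1 := by
  have h := integral_mean (P := P) (X := fun j ω => if J j ω = a then (d : ℝ) else 0)
    fun j => memLp_of_fintype (hJ j) fun b => if b = a then (d : ℝ) else 0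
  unfold rand1Factor
  rw [h]
  have h1 : ∀ j, ∫ ω, (if J j ω = a then (d : ℝ) else 0) ∂P = 1 := by
    intro j
    have h2 := integral_map (μ := P) (hJ j).aemeasurable (f := fun b => if b = a then (d : ℝ) else 0)
      (measurable_of_countable _).aestronglyMeasurable
    rw [← h2, hlaw, integral_uniformFin]
    simp [NeZero.ne d]
  simp [h1, hN]

/-- A single factor equals d with probability 1/d and 0 otherwise: its second moment is d and its
variance d - 1. Averaging N independent copies divides the variance by N. -/
theorem variance_rand1Factor [NeZero d] (hN : N ≠ 0) (hJ : ∀ j, Measurable (J j))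
    (hlaw : ∀ j, P.map (J j) = uniformFin d)
    (hind : Pairwise fun i j => IndepFun (J i) (J j) P) (a : Fin d) :
    Var[fun ω => rand1Factor (fun j => J j ω) a; P] = rand1Omega d / N := by
  have hm : ∀ j, MemLp (fun ω => if J j ω = a then (d : ℝ) else 0) 2 P :=
    fun j => memLp_of_fintype (hJ j) fun b => if b = a then (d : ℝ) else 0
  unfold rand1Factor
  rw [variance_mean hm fun i j hij => (hind hij).comp
    (φ := fun b => if b = a then (d : ℝ) else 0) (ψ := fun b => if b = a then (d : ℝ) else 0)
    (measurable_of_countable _) (measurable_of_countable _)]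
  have h1 : ∀ j, Var[fun ω => if J j ω = a then (d : ℝ) else 0; P] = rand1Omega d := by
    intro j
    have h0 : (d : ℝ) ≠ 0 := by simp [NeZero.ne d]
    rw [variance_eq_sub (hm j)]
    have h2 := integral_map (μ := P) (hJ j).aemeasurable (f := fun b => if b = a then (d : ℝ) else 0)
      (measurable_of_countable _).aestronglyMeasurable
    have h3 := integral_map (μ := P) (hJ j).aemeasurable (f := fun b => (if b = a then (d : ℝ) else 0) ^ 2)
      (measurable_of_countable _).aestronglyMeasurable
    simp only [Pi.pow_apply]
    rw [← h2, ← h3, hlaw, integral_uniformFin, integral_uniformFin]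
    simp [ite_pow, rand1Omega]
    field_simp
  simp only [h1]
  have : (N : ℝ) ≠ 0 := by exact_mod_cast hN
  simp
  field_simp

end Factor

/-! ### One iteration as a map -/

/-- The random draws of one iteration: samples, uplink indices, coin, downlink indices. -/
abbrev Draws (Ξ : Type u) (n d b m l : ℕ) : Type u :=
  (Fin n → Fin b → Ξ) × (Fin n → Fin m → Fin d) × Bool × (Fin n → Fin l → Fin d)

section Step

variable {Ξ : Type u} {n d b m l : ℕ}

/-- The gradient estimator as a function of the draws. -/
def gradOf (G : Vec d → Ξ → Vec d) (y : Draws Ξ n d b m l) (xs : Fin n → Vec d) : Vec d :=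
  (n : ℝ)⁻¹ • ∑ i, ((b : ℝ) * (m : ℝ))⁻¹ •
    ∑ j, rand1 (y.2.1 i j) (∑ r, G (xs i) (y.1 i r))

/-- One iteration, as a function of the state and the draws. -/
def stepMap (G : Vec d → Ξ → Vec d) (γ : ℝ) (s : Vec d × (Fin n → Vec d))
    (y : Draws Ξ n d b m l) : Vec d × (Fin n → Vec d) :=
  (s.1 - γ • gradOf G y s.2, fun i =>
    if y.2.2.1 = true then s.1 - γ • gradOf G y s.2
    else s.2 i + (l : ℝ)⁻¹ • ∑ j, rand1 (y.2.2.2 i j) (s.1 - γ • gradOf G y s.2 - s.1))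

/-- All m compressors of a worker act on the same minibatch sum, so their average separates into a
compression factor times a minibatch mean. -/
theorem gradOf_apply (G : Vec d → Ξ → Vec d) (y : Draws Ξ n d b m l) (xs : Fin n → Vec d)
    (a : Fin d) :
    gradOf G y xs a =
      (n : ℝ)⁻¹ * ∑ i, rand1Factor (y.2.1 i) a * ((b : ℝ)⁻¹ * ∑ r, G (xs i) (y.1 i r) a) := by
  simp only [gradOf, PiLp.smul_apply, smul_eq_mul, WithLp.ofLp_sum, Finset.sum_apply]
  congr 1
  refine Finset.sum_congr rfl fun i _ => ?_
  have h := mean_rand1_apply (y.2.1 i) (∑ r, G (xs i) (y.1 i r)) a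
  simp only [PiLp.smul_apply, smul_eq_mul, WithLp.ofLp_sum, Finset.sum_apply] at h
  rw [mul_inv, mul_assoc, h]
  ring

/-- With δ = -γ g the move of the server and T the compression factor, (x_i + T δ) - (x + δ) = (x_i
- x) + (T - 1) δ; a synchronization kills it. The vector δ is common to all workers. -/
theorem stepMap_sub_apply (G : Vec d → Ξ → Vec d) (γ : ℝ) (s : Vec d × (Fin n → Vec d))
    (y : Draws Ξ n d b m l) (i : Fin n) (a : Fin d) :
    ((stepMap G γ s y).2 i - (stepMap G γ s y).1) a =
      (if y.2.2.1 = true then 0 else 1) *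
        ((s.2 i - s.1) a + (rand1Factor (y.2.2.2 i) a - 1) * (-γ * gradOf G y s.2 a)) := by
  by_cases h : y.2.2.1 = true
  · simp [stepMap, h]
  · have h1 := mean_rand1_apply (y.2.2.2 i) (s.1 - γ • gradOf G y s.2 - s.1) a
    simp only [stepMap, h, if_false, PiLp.sub_apply, PiLp.add_apply, h1, PiLp.smul_apply,
      smul_eq_mul, Bool.false_eq_true]
    ring

variable [MeasurableSpace Ξ]

theorem measurable_rand1 : Measurable fun z : Fin d × Vec d => rand1 z.1 z.2 := by
  refine measurable_from_prod_countable_right fun j => ?_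
  have : Continuous fun v : Vec d => EuclideanSpace.single j ((d : ℝ) * v j) := by
    simp only [EuclideanSpace.single]
    refine (PiLp.continuous_toLp 2 _).comp ?_
    refine continuous_pi fun a => ?_
    by_cases h : a = j
    · subst h; simp only [Pi.single_eq_same]; fun_prop
    · simp only [Pi.single_eq_of_ne h]; fun_prop
  exact this.measurable

theorem measurable_gradOf {G : Vec d → Ξ → Vec d} (hG : Measurable (Function.uncurry G)) :
    Measurable fun z : (Fin n → Vec d) × Draws Ξ n d b m l => gradOf G z.2 z.1 := by
  have h : ∀ (i : Fin n) (r : Fin b),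
      Measurable fun z : (Fin n → Vec d) × Draws Ξ n d b m l => G (z.1 i) (z.2.1 i r) :=
    fun i r => hG.comp (Measurable.prodMk (f := fun z : (Fin n → Vec d) × Draws Ξ n d b m l => z.1 i)
      (g := fun z => z.2.1 i r) (by fun_prop) (by fun_prop))
  have h1 : ∀ i : Fin n, Measurable fun z : (Fin n → Vec d) × Draws Ξ n d b m l =>
      ∑ r, G (z.1 i) (z.2.1 i r) := fun i => Finset.measurable_fun_sum _ fun r _ => h i r
  have h2 : ∀ (i : Fin n) (j : Fin m), Measurable fun z : (Fin n → Vec d) × Draws Ξ n d b m l =>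
      rand1 (z.2.2.1 i j) (∑ r, G (z.1 i) (z.2.1 i r)) := fun i j =>
    measurable_rand1.comp (Measurable.prodMk
      (f := fun z : (Fin n → Vec d) × Draws Ξ n d b m l => z.2.2.1 i j) (by fun_prop) (h1 i))
  exact (Finset.measurable_fun_sum _ fun i _ => (Finset.measurable_fun_sum _ fun j _ =>
    h2 i j).const_smul (((b : ℝ) * (m : ℝ))⁻¹)).const_smul ((n : ℝ)⁻¹)

theorem measurable_stepMap {G : Vec d → Ξ → Vec d} (hG : Measurable (Function.uncurry G)) (γ : ℝ) :
    Measurable fun z : (Vec d × (Fin n → Vec d)) × Draws Ξ n d b m l => stepMap G γ z.1 z.2 := by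
  have hg : Measurable fun z : (Vec d × (Fin n → Vec d)) × Draws Ξ n d b m l =>
      z.1.1 - γ • gradOf G z.2 z.1.2 := by
    have h1 : Measurable fun z : (Vec d × (Fin n → Vec d)) × Draws Ξ n d b m l => (z.1.2, z.2) := by
      fun_prop
    have h2 : Measurable fun z : (Vec d × (Fin n → Vec d)) × Draws Ξ n d b m l => z.1.1 := by
      fun_prop
    exact h2.sub (((measurable_gradOf hG).comp h1).const_smul γ)
  refine hg.prodMk (measurable_pi_lambda _ fun i => Measurable.ite ?_ hg ?_)
  · exact measurableSet_eq_fun (by fun_prop) measurable_const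
  · have h1 : ∀ j : Fin l, Measurable fun z : (Vec d × (Fin n → Vec d)) × Draws Ξ n d b m l =>
        rand1 (z.2.2.2.2 i j) (z.1.1 - γ • gradOf G z.2 z.1.2 - z.1.1) := fun j =>
      measurable_rand1.comp (Measurable.prodMk
        (f := fun z : (Vec d × (Fin n → Vec d)) × Draws Ξ n d b m l => z.2.2.2.2 i j)
        (by fun_prop) (hg.sub (by fun_prop)))
    have h2 : Measurable fun z : (Vec d × (Fin n → Vec d)) × Draws Ξ n d b m l => z.1.2 i := by
      fun_prop
    exact h2.add ((Finset.measurable_fun_sum _ fun j _ => h1 j).const_smul ((l : ℝ)⁻¹))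

end Step

/-! ### Independence of the draws -/

/-- The iteration to which a draw belongs. -/
def Seed.step {n b m l : ℕ} : Seed n b m l → ℕ
  | .sample k _ _ => k
  | .upIdx k _ _ => k
  | .coin k => k
  | .downIdx k _ _ => k

namespace Randomness

variable {Ω : Type v} [MeasurableSpace Ω] {P : Measure Ω} {Ξ : Type u} [MeasurableSpace Ξ]
  {D : Measure Ξ} {n d b m l : ℕ} [NeZero d] {p : ℝ} (R : Randomness P D n d b m l p)

/-- The σ-algebra generated by one draw. -/
@[reducible] def seedAlg (s : Seed n b m l) : MeasurableSpace Ω :=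
  match s with
  | .sample k i r => MeasurableSpace.comap (R.sample k i r) inferInstance
  | .upIdx k i j => MeasurableSpace.comap (R.upIdx k i j) inferInstance
  | .coin k => MeasurableSpace.comap (R.coin k) inferInstance
  | .downIdx k i j => MeasurableSpace.comap (R.downIdx k i j) inferInstance

/-- The σ-algebra generated by a set of draws. -/
@[reducible] def alg (S : Set (Seed n b m l)) : MeasurableSpace Ω := ⨆ s ∈ S, R.seedAlg s

theorem alg_mono {S T : Set (Seed n b m l)} (h : S ⊆ T) : R.alg S ≤ R.alg T :=
  biSup_mono h

theorem seedAlg_le (s : Seed n b m l) : R.seedAlg s ≤ ‹MeasurableSpace Ω› := by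
  cases s with
  | sample k i r => exact (R.measurable_sample k i r).comap_le
  | upIdx k i j => exact (R.measurable_upIdx k i j).comap_le
  | coin k => exact (R.measurable_coin k).comap_le
  | downIdx k i j => exact (R.measurable_downIdx k i j).comap_le

theorem alg_le (S : Set (Seed n b m l)) : R.alg S ≤ ‹MeasurableSpace Ω› :=
  iSup₂_le fun s _ => R.seedAlg_le s

theorem seedAlg_le_alg {S : Set (Seed n b m l)} {s : Seed n b m l} (hs : s ∈ S) :
    R.seedAlg s ≤ R.alg S :=
  le_iSup₂_of_le s hs le_rfl

theorem measurable_alg_sample {S : Set (Seed n b m l)} {k i r} (h : Seed.sample k i r ∈ S) :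
    Measurable[R.alg S] (R.sample k i r) :=
  (comap_measurable _).mono (R.seedAlg_le_alg h) le_rfl

theorem measurable_alg_upIdx {S : Set (Seed n b m l)} {k i j} (h : Seed.upIdx k i j ∈ S) :
    Measurable[R.alg S] (R.upIdx k i j) :=
  (comap_measurable _).mono (R.seedAlg_le_alg h) le_rfl

theorem measurable_alg_coin {S : Set (Seed n b m l)} {k} (h : Seed.coin k ∈ S) :
    Measurable[R.alg S] (R.coin k) :=
  (comap_measurable _).mono (R.seedAlg_le_alg h) le_rfl

theorem measurable_alg_downIdx {S : Set (Seed n b m l)} {k i j} (h : Seed.downIdx k i j ∈ S) :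
    Measurable[R.alg S] (R.downIdx k i j) :=
  (comap_measurable _).mono (R.seedAlg_le_alg h) le_rfl

/-- Every independence needed below is reduced to the disjointness of two sets of `Seed` labels. -/
theorem indepFun_of_disjoint {α β : Type*} [MeasurableSpace α] [MeasurableSpace β] {X : Ω → α}
    {Y : Ω → β} {S T : Set (Seed n b m l)} (hST : Disjoint S T) (hX : Measurable[R.alg S] X)
    (hY : Measurable[R.alg T] Y) : IndepFun X Y P := by
  rw [IndepFun_iff_Indep]
  have h : Indep (R.alg S) (R.alg T) P :=
    indep_iSup_of_disjoint (m := R.seedAlg) R.seedAlg_le R.indep hST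
  exact indep_of_indep_of_le_left (indep_of_indep_of_le_right h hY.comap_le) hX.comap_le

/-- All draws of iteration `k`. -/
def draws (k : ℕ) (ω : Ω) : Draws Ξ n d b m l :=
  (fun i r => R.sample k i r ω, fun i j => R.upIdx k i j ω, R.coin k ω,
    fun i j => R.downIdx k i j ω)

theorem measurable_alg_draws {S : Set (Seed n b m l)} {k : ℕ} (h : {s | s.step = k} ⊆ S) :
    Measurable[R.alg S] (R.draws k) := by
  have h1 : Measurable[R.alg S] fun ω i r => R.sample k i r ω :=
    @measurable_pi_lambda _ _ _ (R.alg S) _ _ fun i => @measurable_pi_lambda _ _ _ (R.alg S) _ _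
      fun r => R.measurable_alg_sample (h rfl)
  have h2 : Measurable[R.alg S] fun ω i r => R.upIdx k i r ω :=
    @measurable_pi_lambda _ _ _ (R.alg S) _ _ fun i => @measurable_pi_lambda _ _ _ (R.alg S) _ _
      fun r => R.measurable_alg_upIdx (h rfl)
  have h3 : Measurable[R.alg S] fun ω i r => R.downIdx k i r ω :=
    @measurable_pi_lambda _ _ _ (R.alg S) _ _ fun i => @measurable_pi_lambda _ _ _ (R.alg S) _ _
      fun r => R.measurable_alg_downIdx (h rfl)
  have h4 : Measurable[R.alg S] (R.coin k) := R.measurable_alg_coin (h rfl)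
  exact h1.prodMk (h2.prodMk (h4.prodMk h3))

theorem measurable_draws (k : ℕ) : Measurable (R.draws k) :=
  (R.measurable_alg_draws subset_rfl).mono (R.alg_le _) le_rfl

theorem state_succ (G : Vec d → Ξ → Vec d) (γ : ℝ) (x0 : Vec d) (ω : Ω) (k : ℕ) :
    state R G γ x0 ω (k + 1) = stepMap G γ (state R G γ x0 ω k) (R.draws k ω) := rfl

/-- The state depends on strictly earlier iterations only; this is what makes it independent of the
current draws. -/
theorem measurable_alg_state {G : Vec d → Ξ → Vec d} (hG : Measurable (Function.uncurry G))
    (γ : ℝ) (x0 : Vec d) (k : ℕ) :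
    Measurable[R.alg {s | s.step < k}] fun ω => state R G γ x0 ω k := by
  induction k with
  | zero => exact @measurable_const _ _ _ (R.alg _) _
  | succ k ih =>
    simp only [state_succ]
    refine (measurable_stepMap hG γ).comp (Measurable.prodMk ?_ ?_)
    · exact ih.mono (R.alg_mono fun s hs => Nat.lt_succ_of_lt hs) le_rfl
    · exact R.measurable_alg_draws fun s hs => by
        simp only [Set.mem_ofPred_eq] at hs ⊢; omega

theorem measurable_state {G : Vec d → Ξ → Vec d} (hG : Measurable (Function.uncurry G))
    (γ : ℝ) (x0 : Vec d) (k : ℕ) : Measurable fun ω => state R G γ x0 ω k :=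
  (R.measurable_alg_state hG γ x0 k).mono (R.alg_le _) le_rfl

theorem indepFun_state_draws {G : Vec d → Ξ → Vec d} (hG : Measurable (Function.uncurry G))
    (γ : ℝ) (x0 : Vec d) (k : ℕ) :
    IndepFun (fun ω => state R G γ x0 ω k) (R.draws k) P :=
  R.indepFun_of_disjoint (Set.disjoint_left.2 fun s h1 h2 => by
    simp only [Set.mem_ofPred_eq] at h1 h2; omega) (R.measurable_alg_state hG γ x0 k)
    (R.measurable_alg_draws subset_rfl)

end Randomness

/-! ### Vector moments from coordinates -/

section VectorMoments

variable {Ω : Type v} [MeasurableSpace Ω] {P : Measure Ω} {d : ℕ}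

theorem norm_sq_eq_sum (x : Vec d) : ‖x‖ ^ 2 = ∑ a, x a ^ 2 := by
  simp [EuclideanSpace.norm_sq_eq]

theorem integrable_norm_sq_of_coord {X : Ω → Vec d} (hX : ∀ a, MemLp (fun ω => X ω a) 2 P) :
    Integrable (fun ω => ‖X ω‖ ^ 2) P := by
  simp only [norm_sq_eq_sum]
  exact integrable_finsetSum _ fun a _ => (hX a).integrable_sq

theorem integral_norm_sq_of_coord {X : Ω → Vec d} (hX : ∀ a, MemLp (fun ω => X ω a) 2 P) :
    ∫ ω, ‖X ω‖ ^ 2 ∂P = ∑ a, ∫ ω, X ω a ^ 2 ∂P := by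
  simp only [norm_sq_eq_sum]
  exact integral_finsetSum _ fun a _ => (hX a).integrable_sq

theorem inner_eq_sum (x y : Vec d) : inner ℝ x y = ∑ a, x a * y a := by
  simp [PiLp.inner_apply, mul_comm]

theorem integrable_inner_of_coord [IsProbabilityMeasure P] {X : Ω → Vec d}
    (hX : ∀ a, MemLp (fun ω => X ω a) 2 P) (w : Vec d) :
    Integrable (fun ω => inner ℝ w (X ω)) P := by
  simp only [inner_eq_sum]
  exact integrable_finsetSum _ fun a _ => ((hX a).integrable one_le_two).const_mul _

theorem integral_inner_of_coord [IsProbabilityMeasure P] {X : Ω → Vec d}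
    (hX : ∀ a, MemLp (fun ω => X ω a) 2 P) (w : Vec d) {e : Vec d}
    (he : ∀ a, ∫ ω, X ω a ∂P = e a) :
    ∫ ω, inner ℝ w (X ω) ∂P = inner ℝ w e := by
  simp only [inner_eq_sum]
  rw [integral_finsetSum _ fun a _ => ((hX a).integrable one_le_two).const_mul _]
  simp only [integral_const_mul, he]

end VectorMoments

namespace IsStochasticGradient

variable {d : ℕ} {Ξ : Type u} [MeasurableSpace Ξ] {f : Vec d → ℝ} {G : Vec d → Ξ → Vec d}
  {D : Measure Ξ} [IsProbabilityMeasure D] {σ : ℝ}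

theorem memLp_coord (h : IsStochasticGradient f G D σ) (x : Vec d) (a : Fin d) :
    MemLp (fun ξ => G x ξ a) 2 D := by
  have hm : AEStronglyMeasurable (fun ξ => G x ξ - gradient f x) D :=
    (h.integrable x).aestronglyMeasurable.sub aestronglyMeasurable_const
  have h1 : MemLp (fun ξ => G x ξ - gradient f x) 2 D :=
    (memLp_two_iff_integrable_sq_norm hm).2 (h.sq_integrable x)
  have h2 : MemLp (fun ξ => G x ξ) 2 D := by
    refine (h1.add (memLp_const (gradient f x))).ae_eq (ae_of_all _ fun ξ => ?_)
    simp
  exact ((EuclideanSpace.proj a : Vec d →L[ℝ] ℝ).comp_memLp' h2)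

theorem integral_coord (h : IsStochasticGradient f G D σ) (x : Vec d) (a : Fin d) :
    ∫ ξ, G x ξ a ∂D = gradient f x a := by
  rw [← h.unbiased x]
  exact (EuclideanSpace.proj a : Vec d →L[ℝ] ℝ).integral_comp_comm (h.integrable x)

theorem sum_variance_le (h : IsStochasticGradient f G D σ) (x : Vec d) :
    ∑ a, Var[fun ξ => G x ξ a; D] ≤ σ ^ 2 := by
  refine le_trans (le_of_eq ?_) (h.variance_le x)
  rw [integral_norm_sq_of_coord fun a => ?_]
  · refine Finset.sum_congr rfl fun a _ => ?_
    rw [variance_eq_integral (h.memLp_coord x a).aestronglyMeasurable.aemeasurable,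
      h.integral_coord]
    rfl
  · exact (h.memLp_coord x a).sub (memLp_const _)

end IsStochasticGradient

/-! ### Moments of one iteration -/

theorem integral_bernoulliBool {p : ℝ} (hp : p ∈ Set.Icc (0 : ℝ) 1) (F : Bool → ℝ) :
    ∫ c, F c ∂(bernoulliBool p) = p * F true + (1 - p) * F false := by
  have h0 : (0 : ℝ) ≤ 1 - p := by linarith [hp.2]
  rw [bernoulliBool, integral_add_measure, integral_smul_measure, integral_smul_measure,
    integral_dirac, integral_dirac, ENNReal.toReal_ofReal hp.1, ENNReal.toReal_ofReal h0]
  · simp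
  · exact (integrable_dirac (by simp)).smul_measure (by simp)
  · exact (integrable_dirac (by simp)).smul_measure (by simp)

namespace Randomness

variable {Ω : Type v} [MeasurableSpace Ω] {P : Measure Ω} [IsProbabilityMeasure P] {Ξ : Type u}
  [MeasurableSpace Ξ] {D : Measure Ξ} [IsProbabilityMeasure D] {n d b m l : ℕ} [NeZero d] {p : ℝ}
  (R : Randomness P D n d b m l p) {f : Vec d → ℝ} {G : Vec d → Ξ → Vec d} {σ : ℝ}

theorem integral_coin (hp : p ∈ Set.Icc (0 : ℝ) 1) (k : ℕ) (F : Bool → ℝ) :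
    ∫ ω, F (R.coin k ω) ∂P = p * F true + (1 - p) * F false := by
  rw [← integral_bernoulliBool hp, ← R.law_coin k,
    integral_map (R.measurable_coin k).aemeasurable
      (measurable_of_countable F).aestronglyMeasurable]

/-- Coordinate `a` of the minibatch gradient of a worker at `x`. -/
def minibatch (R : Randomness P D n d b m l p) (G : Vec d → Ξ → Vec d) (k : ℕ) (i : Fin n)
    (x : Vec d) (a : Fin d) (ω : Ω) : ℝ :=
  (b : ℝ)⁻¹ * ∑ r, G x (R.sample k i r ω) a

theorem measurable_G_coord (hG : Measurable (Function.uncurry G)) (x : Vec d) (a : Fin d) :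
    Measurable fun ξ => G x ξ a := by
  have h : Measurable fun ξ => G x ξ := hG.comp measurable_prodMk_left
  fun_prop

theorem memLp_sample (h : IsStochasticGradient f G D σ) (k : ℕ) (i : Fin n) (r : Fin b)
    (x : Vec d) (a : Fin d) : MemLp (fun ω => G x (R.sample k i r ω) a) 2 P := by
  have h1 := h.memLp_coord x a
  rw [← R.law_sample k i r] at h1
  exact h1.comp_of_map (R.measurable_sample k i r).aemeasurable

theorem memLp_minibatch (h : IsStochasticGradient f G D σ) (k : ℕ) (i : Fin n)
    (x : Vec d) (a : Fin d) : MemLp (R.minibatch G k i x a) 2 P :=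
  memLp_mean fun r => R.memLp_sample h k i r x a

theorem integral_minibatch (hb : b ≠ 0) (h : IsStochasticGradient f G D σ) (k : ℕ) (i : Fin n)
    (x : Vec d) (a : Fin d) : ∫ ω, R.minibatch G k i x a ω ∂P = gradient f x a := by
  unfold minibatch
  rw [integral_mean fun r => R.memLp_sample h k i r x a]
  have h1 : ∀ r, ∫ ω, G x (R.sample k i r ω) a ∂P = gradient f x a := fun r => by
    have h2 := integral_map (μ := P) (R.measurable_sample k i r).aemeasurable
      (measurable_G_coord h.measurable x a).aestronglyMeasurable
    rw [← h2, R.law_sample, h.integral_coord]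
  simp [h1, hb]

theorem variance_minibatch (hb : b ≠ 0) (h : IsStochasticGradient f G D σ) (k : ℕ) (i : Fin n)
    (x : Vec d) (a : Fin d) :
    Var[R.minibatch G k i x a; P] = (b : ℝ)⁻¹ * Var[fun ξ => G x ξ a; D] := by
  have hG := measurable_G_coord h.measurable x a
  unfold minibatch
  rw [variance_mean (fun r => R.memLp_sample h k i r x a) fun r r' hr => ?_]
  · have h1 : ∀ r, Var[fun ω => G x (R.sample k i r ω) a; P] = Var[fun ξ => G x ξ a; D] :=
      fun r => by
        have h2 := variance_map (μ := P) hG.aemeasurable (R.measurable_sample k i r).aemeasurable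
        rw [R.law_sample] at h2
        exact h2.symm
    have : (b : ℝ) ≠ 0 := by exact_mod_cast hb
    simp [h1]
    field_simp
  · refine (R.indepFun_of_disjoint (S := {.sample k i r}) (T := {.sample k i r'}) (by simpa using hr)
      (R.measurable_alg_sample rfl) (R.measurable_alg_sample rfl)).comp hG hG

/-- The draws of iteration `k` that worker `i` uses for its uplink messages. -/
def upSeeds (n b m l k : ℕ) (i : Fin n) : Set (Seed n b m l) :=
  Set.range (Seed.sample k i) ∪ Set.range (Seed.upIdx k i)

theorem measurable_alg_minibatch (hG : Measurable (Function.uncurry G)) {S : Set (Seed n b m l)}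
    {k : ℕ} {i : Fin n} (hS : Set.range (Seed.sample k i) ⊆ S) (x : Vec d) (a : Fin d) :
    Measurable[R.alg S] (R.minibatch G k i x a) := by
  refine Measurable.const_mul (Finset.measurable_fun_sum _ fun r _ => ?_) _
  exact (measurable_G_coord hG x a).comp (R.measurable_alg_sample (hS ⟨r, rfl⟩))

theorem measurable_alg_upFactor {S : Set (Seed n b m l)} {k : ℕ} {i : Fin n}
    (hS : Set.range (Seed.upIdx k i) ⊆ S) (a : Fin d) :
    Measurable[R.alg S] fun ω => rand1Factor (fun j => R.upIdx k i j ω) a := by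
  have h : Measurable[R.alg S] fun ω j => R.upIdx k i j ω :=
    @measurable_pi_lambda _ _ _ (R.alg S) _ _ fun j => R.measurable_alg_upIdx (hS ⟨j, rfl⟩)
  exact (measurable_of_countable fun J : Fin m → Fin d => rand1Factor J a).comp h

theorem measurable_alg_downFactor {S : Set (Seed n b m l)} {k : ℕ} {i : Fin n}
    (hS : Set.range (Seed.downIdx k i) ⊆ S) (a : Fin d) :
    Measurable[R.alg S] fun ω => rand1Factor (fun j => R.downIdx k i j ω) a := by
  have h : Measurable[R.alg S] fun ω j => R.downIdx k i j ω :=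
    @measurable_pi_lambda _ _ _ (R.alg S) _ _ fun j => R.measurable_alg_downIdx (hS ⟨j, rfl⟩)
  exact (measurable_of_countable fun J : Fin l → Fin d => rand1Factor J a).comp h

theorem indepFun_upIdx (k : ℕ) (i : Fin n) :
    Pairwise fun j j' => IndepFun (R.upIdx k i j) (R.upIdx k i j') P := fun j j' hj =>
  R.indepFun_of_disjoint (S := {.upIdx k i j}) (T := {.upIdx k i j'}) (by simpa using hj)
    (R.measurable_alg_upIdx rfl) (R.measurable_alg_upIdx rfl)

theorem indepFun_downIdx (k : ℕ) (i : Fin n) :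
    Pairwise fun j j' => IndepFun (R.downIdx k i j) (R.downIdx k i j') P := fun j j' hj =>
  R.indepFun_of_disjoint (S := {.downIdx k i j}) (T := {.downIdx k i j'}) (by simpa using hj)
    (R.measurable_alg_downIdx rfl) (R.measurable_alg_downIdx rfl)

/-- Coordinate `a` of the average of the uplink messages of worker `i`. -/
def uplink (R : Randomness P D n d b m l p) (G : Vec d → Ξ → Vec d) (k : ℕ) (i : Fin n)
    (x : Vec d) (a : Fin d) (ω : Ω) : ℝ :=
  rand1Factor (fun j => R.upIdx k i j ω) a * R.minibatch G k i x a ω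

theorem measurable_alg_uplink (hG : Measurable (Function.uncurry G)) {S : Set (Seed n b m l)}
    {k : ℕ} {i : Fin n} (hS : upSeeds n b m l k i ⊆ S) (x : Vec d) (a : Fin d) :
    Measurable[R.alg S] (R.uplink G k i x a) :=
  Measurable.fun_mul
    (R.measurable_alg_upFactor (Set.subset_union_right.trans hS) a)
    (R.measurable_alg_minibatch hG (Set.subset_union_left.trans hS) x a)

theorem indepFun_upFactor_minibatch (hG : Measurable (Function.uncurry G)) (k : ℕ) (i : Fin n)
    (x : Vec d) (a : Fin d) :
    IndepFun (fun ω => rand1Factor (fun j => R.upIdx k i j ω) a) (R.minibatch G k i x a) P := by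
  refine R.indepFun_of_disjoint ?_ (R.measurable_alg_upFactor subset_rfl a)
    (R.measurable_alg_minibatch hG subset_rfl x a)
  simp [Set.disjoint_left]

theorem memLp_uplink (h : IsStochasticGradient f G D σ) (k : ℕ) (i : Fin n)
    (x : Vec d) (a : Fin d) : MemLp (R.uplink G k i x a) 2 P :=
  memLp_mul_of_indepFun (memLp_rand1Factor (fun j => R.measurable_upIdx k i j) a)
    (R.memLp_minibatch h k i x a) (R.indepFun_upFactor_minibatch h.measurable k i x a)

theorem integral_uplink (hb : b ≠ 0) (hm : m ≠ 0) (h : IsStochasticGradient f G D σ) (k : ℕ)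
    (i : Fin n) (x : Vec d) (a : Fin d) : ∫ ω, R.uplink G k i x a ω ∂P = gradient f x a := by
  unfold uplink
  rw [integral_mul_of_indepFun (memLp_rand1Factor (fun j => R.measurable_upIdx k i j) a)
    (R.memLp_minibatch h k i x a) (R.indepFun_upFactor_minibatch h.measurable k i x a),
    integral_rand1Factor hm (fun j => R.measurable_upIdx k i j) (fun j => R.law_upIdx k i j),
    R.integral_minibatch hb h, one_mul]

/-- The second moment of a product of independent variables factors. Subtracting the squared mean μ²
from (1 + ω/m)(μ² + v), with v the minibatch variance, leaves the two terms. -/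
theorem variance_uplink (hb : b ≠ 0) (hm : m ≠ 0) (h : IsStochasticGradient f G D σ) (k : ℕ)
    (i : Fin n) (x : Vec d) (a : Fin d) :
    Var[R.uplink G k i x a; P] = rand1Omega d / m * gradient f x a ^ 2 +
      (rand1Omega d / m + 1) * ((b : ℝ)⁻¹ * Var[fun ξ => G x ξ a; D]) := by
  have hS := memLp_rand1Factor (P := P) (fun j => R.measurable_upIdx k i j) a
  have hv := R.memLp_minibatch h k i x a
  have h1 := integral_sq_eq_variance_add (R.memLp_uplink h k i x a)
  have h2 : ∫ ω, R.uplink G k i x a ω ^ 2 ∂P = _ :=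
    integral_sq_mul_of_indepFun hS hv (R.indepFun_upFactor_minibatch h.measurable k i x a)
  rw [integral_sq_eq_variance_add hS, integral_sq_eq_variance_add hv,
    integral_rand1Factor hm (fun j => R.measurable_upIdx k i j) (fun j => R.law_upIdx k i j),
    variance_rand1Factor hm (fun j => R.measurable_upIdx k i j) (fun j => R.law_upIdx k i j)
      (R.indepFun_upIdx k i), R.integral_minibatch hb h, R.variance_minibatch hb h, h1,
    R.integral_uplink hb hm h] at h2
  linear_combination h2

theorem gradOf_draws_apply (k : ℕ) (ω : Ω) (xs : Fin n → Vec d) (a : Fin d) :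
    gradOf G (R.draws k ω) xs a = (n : ℝ)⁻¹ * ∑ i, R.uplink G k i (xs i) a ω :=
  gradOf_apply _ _ _ _

theorem memLp_gradOf (h : IsStochasticGradient f G D σ) (k : ℕ) (xs : Fin n → Vec d)
    (a : Fin d) : MemLp (fun ω => gradOf G (R.draws k ω) xs a) 2 P := by
  simp only [gradOf_draws_apply]
  exact memLp_mean fun i => R.memLp_uplink h k i (xs i) a

/-- The mean of the gradients at the local points. -/
def meanGradient (f : Vec d → ℝ) (xs : Fin n → Vec d) : Vec d :=
  (n : ℝ)⁻¹ • ∑ i, gradient f (xs i)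

theorem integral_gradOf (hb : b ≠ 0) (hm : m ≠ 0) (h : IsStochasticGradient f G D σ) (k : ℕ)
    (xs : Fin n → Vec d) (a : Fin d) :
    ∫ ω, gradOf G (R.draws k ω) xs a ∂P = meanGradient f xs a := by
  simp only [gradOf_draws_apply]
  rw [integral_mean fun i => R.memLp_uplink h k i (xs i) a]
  simp [R.integral_uplink hb hm h, meanGradient]

theorem variance_gradOf (hb : b ≠ 0) (hm : m ≠ 0) (h : IsStochasticGradient f G D σ) (k : ℕ)
    (xs : Fin n → Vec d) (a : Fin d) :
    Var[fun ω => gradOf G (R.draws k ω) xs a; P] =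
      ((n : ℝ)⁻¹) ^ 2 * ∑ i, (rand1Omega d / m * gradient f (xs i) a ^ 2 +
        (rand1Omega d / m + 1) * ((b : ℝ)⁻¹ * Var[fun ξ => G (xs i) ξ a; D])) := by
  simp only [gradOf_draws_apply]
  rw [variance_mean (fun i => R.memLp_uplink h k i (xs i) a) fun i i' hi => ?_]
  · simp only [R.variance_uplink hb hm h]
  · refine R.indepFun_of_disjoint ?_ (R.measurable_alg_uplink h.measurable subset_rfl (xs i) a)
      (R.measurable_alg_uplink h.measurable subset_rfl (xs i') a)
    rw [Set.disjoint_left]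
    rintro s (⟨r, rfl⟩ | ⟨r, rfl⟩) (⟨r', hr⟩ | ⟨r', hr⟩) <;> simp at hr
    · exact hi hr.1.symm
    · exact hi hr.1.symm

/-- Workers are independent, so averaging over them divides compression and sampling variance by n;
only the squared norm of the mean gradient is not reduced. -/
theorem integral_norm_gradOf_sq_le [NeZero n] (hb : b ≠ 0) (hm : m ≠ 0)
    (h : IsStochasticGradient f G D σ) (k : ℕ) (xs : Fin n → Vec d) :
    ∫ ω, ‖gradOf G (R.draws k ω) xs‖ ^ 2 ∂P ≤ ‖meanGradient f xs‖ ^ 2 +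
      rand1Omega d / (n * m) * ((n : ℝ)⁻¹ * ∑ i, ‖gradient f (xs i)‖ ^ 2) +
      (rand1Omega d / m + 1) * (σ ^ 2 / (n * b)) := by
  have hn : (n : ℝ) ≠ 0 := by exact_mod_cast NeZero.ne n
  have hd : 0 ≤ rand1Omega d := by
    have : (1 : ℝ) ≤ d := by exact_mod_cast NeZero.one_le
    unfold rand1Omega; linarith
  rw [integral_norm_sq_of_coord fun a => R.memLp_gradOf h k xs a]
  have h1 : ∀ a, ∫ ω, gradOf G (R.draws k ω) xs a ^ 2 ∂P = _ := fun a =>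
    integral_sq_eq_variance_add (R.memLp_gradOf h k xs a)
  simp only [h1, R.variance_gradOf hb hm h, R.integral_gradOf hb hm h]
  rw [Finset.sum_add_distrib, ← norm_sq_eq_sum, ← Finset.mul_sum, Finset.sum_comm]
  simp only [Finset.sum_add_distrib, ← Finset.mul_sum, ← norm_sq_eq_sum]
  have h2 : ∑ i, ∑ a, Var[fun ξ => G (xs i) ξ a; D] ≤ n * σ ^ 2 := by
    refine (Finset.sum_le_sum fun i _ => h.sum_variance_le (xs i)).trans ?_
    simp
  have h3 : ((n : ℝ)⁻¹) ^ 2 * ((rand1Omega d / m + 1) * ((b : ℝ)⁻¹ *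
      ∑ i, ∑ a, Var[fun ξ => G (xs i) ξ a; D])) ≤
      ((n : ℝ)⁻¹) ^ 2 * ((rand1Omega d / m + 1) * ((b : ℝ)⁻¹ * (n * σ ^ 2))) := by gcongr
  have h4 : ((n : ℝ)⁻¹) ^ 2 * ((rand1Omega d / m + 1) * ((b : ℝ)⁻¹ * (n * σ ^ 2))) =
      (rand1Omega d / m + 1) * (σ ^ 2 / (n * b)) := by
    field_simp
  have h5 : ((n : ℝ)⁻¹) ^ 2 * (rand1Omega d / m * ∑ i, ‖gradient f (xs i)‖ ^ 2) =
      rand1Omega d / (n * m) * ((n : ℝ)⁻¹ * ∑ i, ‖gradient f (xs i)‖ ^ 2) := by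
    field_simp
  linarith

/-- The draws of iteration `k` used for the uplink messages. -/
def allUpSeeds (n b m l k : ℕ) : Set (Seed n b m l) := ⋃ i, upSeeds n b m l k i

/-- The draws of iteration `k` used for the downlink messages. -/
def allDownSeeds (n b m l k : ℕ) : Set (Seed n b m l) := ⋃ i, Set.range (Seed.downIdx k i)

theorem disjoint_down_up (k : ℕ) : Disjoint (allDownSeeds n b m l k) (allUpSeeds n b m l k) := by
  rw [Set.disjoint_left]
  intro s h1 h2
  obtain ⟨i, r, rfl⟩ := Set.mem_iUnion.1 h1
  obtain ⟨i', ⟨r', hr⟩ | ⟨r', hr⟩⟩ := Set.mem_iUnion.1 h2 <;> simp at hr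

theorem measurable_alg_gradOf (hG : Measurable (Function.uncurry G)) {S : Set (Seed n b m l)}
    {k : ℕ} (hS : allUpSeeds n b m l k ⊆ S) (xs : Fin n → Vec d) (a : Fin d) :
    Measurable[R.alg S] fun ω => gradOf G (R.draws k ω) xs a := by
  simp only [gradOf_draws_apply]
  exact (Finset.measurable_fun_sum _ fun i _ =>
    R.measurable_alg_uplink hG ((Set.subset_iUnion _ i).trans hS) (xs i) a).const_mul _

/-- Second moments of the displacement of a coordinate, when the compression factor is `T`. -/
theorem displacement_moment (hp : p ∈ Set.Icc (0 : ℝ) 1) (h : IsStochasticGradient f G D σ)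
    (k : ℕ) (xs : Fin n → Vec d) (a : Fin d) (γ u : ℝ) {T : Ω → ℝ} (hT : MemLp T 2 P)
    (hTm : Measurable[R.alg (allDownSeeds n b m l k)] T) (hT1 : ∫ ω, T ω ∂P = 1) :
    MemLp (fun ω => (if R.coin k ω = true then 0 else 1) *
        (u + (T ω - 1) * (-γ * gradOf G (R.draws k ω) xs a))) 2 P ∧
      ∫ ω, ((if R.coin k ω = true then 0 else 1) *
        (u + (T ω - 1) * (-γ * gradOf G (R.draws k ω) xs a))) ^ 2 ∂P =
      (1 - p) * (u ^ 2 + Var[T; P] * (γ ^ 2 * ∫ ω, gradOf G (R.draws k ω) xs a ^ 2 ∂P)) := by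
  have hδ : MemLp (fun ω => -γ * gradOf G (R.draws k ω) xs a) 2 P :=
    (R.memLp_gradOf h k xs a).const_mul _
  have hδm : ∀ S, allUpSeeds n b m l k ⊆ S →
      Measurable[R.alg S] fun ω => -γ * gradOf G (R.draws k ω) xs a := fun S hS =>
    (R.measurable_alg_gradOf h.measurable hS xs a).const_mul _
  have hc : MemLp (fun ω => if R.coin k ω = true then (0 : ℝ) else 1) 2 P :=
    memLp_of_fintype (R.measurable_coin k) fun c => if c = true then (0 : ℝ) else 1
  have hind := R.indepFun_of_disjoint (disjoint_down_up k) hTm (hδm _ subset_rfl)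
  have hcind : IndepFun (fun ω => if R.coin k ω = true then (0 : ℝ) else 1)
      (fun ω => u + (T ω - 1) * (-γ * gradOf G (R.draws k ω) xs a)) P := by
    refine R.indepFun_of_disjoint (S := {.coin k})
      (T := allDownSeeds n b m l k ∪ allUpSeeds n b m l k) ?_ ?_ ?_
    · simp [allDownSeeds, allUpSeeds, upSeeds]
    · exact (measurable_of_countable fun c : Bool => if c = true then (0 : ℝ) else 1).comp
        (R.measurable_alg_coin rfl)
    · have h1 : Measurable[R.alg (allDownSeeds n b m l k ∪ allUpSeeds n b m l k)] T :=
        hTm.mono (R.alg_mono Set.subset_union_left) le_rfl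
      have h2 := hδm (allDownSeeds n b m l k ∪ allUpSeeds n b m l k) Set.subset_union_right
      have h3 : Measurable fun z : ℝ × ℝ => u + (z.1 - 1) * z.2 := by fun_prop
      exact h3.comp (h1.prodMk h2)
  obtain ⟨h1, h2⟩ := displaced_moment hc hT hδ hind u hcind hT1
  refine ⟨h1, ?_⟩
  rw [h2]
  have h3 := R.integral_coin hp k fun c => (if c = true then (0 : ℝ) else 1) ^ 2
  rw [h3]
  simp only [mul_pow, neg_sq, integral_const_mul]
  simp

/-- `displacement_moment` in each coordinate, with the downlink factor of one worker, of variance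
ω/l. -/
theorem displacement_worker (hp : p ∈ Set.Icc (0 : ℝ) 1) (hl : l ≠ 0)
    (h : IsStochasticGradient f G D σ) (k : ℕ) (s : Vec d × (Fin n → Vec d)) (γ : ℝ) (i : Fin n) :
    Integrable (fun ω => ‖(stepMap G γ s (R.draws k ω)).2 i - (stepMap G γ s (R.draws k ω)).1‖ ^ 2)
        P ∧
      ∫ ω, ‖(stepMap G γ s (R.draws k ω)).2 i - (stepMap G γ s (R.draws k ω)).1‖ ^ 2 ∂P =
        (1 - p) * (‖s.2 i - s.1‖ ^ 2 +
          rand1Omega d / l * (γ ^ 2 * ∫ ω, ‖gradOf G (R.draws k ω) s.2‖ ^ 2 ∂P)) := by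
  have key := fun a => R.displacement_moment hp h k s.2 a γ ((s.2 i - s.1) a)
    (memLp_rand1Factor (fun j => R.measurable_downIdx k i j) a)
    (R.measurable_alg_downFactor
      (Set.subset_iUnion (fun i => Set.range (Seed.downIdx k i)) i) a)
    (integral_rand1Factor hl (fun j => R.measurable_downIdx k i j)
      (fun j => R.law_downIdx k i j) a)
  have heq : ∀ a ω, ((stepMap G γ s (R.draws k ω)).2 i - (stepMap G γ s (R.draws k ω)).1) a =
      (if R.coin k ω = true then 0 else 1) * ((s.2 i - s.1) a +
        (rand1Factor (fun j => R.downIdx k i j ω) a - 1) * (-γ * gradOf G (R.draws k ω) s.2 a)) :=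
    fun a ω => stepMap_sub_apply _ _ _ _ _ _
  have hmem : ∀ a, MemLp (fun ω =>
      ((stepMap G γ s (R.draws k ω)).2 i - (stepMap G γ s (R.draws k ω)).1) a) 2 P := fun a => by
    simp only [heq]; exact (key a).1
  refine ⟨integrable_norm_sq_of_coord hmem, ?_⟩
  rw [integral_norm_sq_of_coord hmem, integral_norm_sq_of_coord (R.memLp_gradOf h k s.2),
    norm_sq_eq_sum]
  simp only [heq, (key _).2, variance_rand1Factor hl (fun j => R.measurable_downIdx k i j)
      (fun j => R.law_downIdx k i j) (R.indepFun_downIdx k i)]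
  simp only [Finset.mul_sum, ← Finset.sum_add_distrib]

/-- Since all workers compress the same vector, the mean displacement obeys the recursion of a
single one with the averaged factor `T`. The independence of the workers lowers its variance to
ω/(nl). -/
theorem displacement_mean [NeZero n] (hp : p ∈ Set.Icc (0 : ℝ) 1) (hl : l ≠ 0)
    (h : IsStochasticGradient f G D σ) (k : ℕ) (s : Vec d × (Fin n → Vec d)) (γ : ℝ) :
    Integrable (fun ω => ‖(n : ℝ)⁻¹ •
        ∑ i, ((stepMap G γ s (R.draws k ω)).2 i - (stepMap G γ s (R.draws k ω)).1)‖ ^ 2) P ∧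
      ∫ ω, ‖(n : ℝ)⁻¹ •
          ∑ i, ((stepMap G γ s (R.draws k ω)).2 i - (stepMap G γ s (R.draws k ω)).1)‖ ^ 2 ∂P =
        (1 - p) * (‖(n : ℝ)⁻¹ • ∑ i, (s.2 i - s.1)‖ ^ 2 +
          rand1Omega d / (n * l) * (γ ^ 2 * ∫ ω, ‖gradOf G (R.draws k ω) s.2‖ ^ 2 ∂P)) := by
  have hn : (n : ℝ) ≠ 0 := by exact_mod_cast NeZero.ne n
  set T : Fin d → Ω → ℝ := fun a ω =>
    (n : ℝ)⁻¹ * ∑ i, rand1Factor (fun j => R.downIdx k i j ω) a with hTdef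
  have hTi : ∀ a i, MemLp (fun ω => rand1Factor (fun j => R.downIdx k i j ω) a) 2 P := fun a i =>
    memLp_rand1Factor (fun j => R.measurable_downIdx k i j) a
  have hT : ∀ a, MemLp (T a) 2 P := fun a => memLp_mean (hTi a)
  have hTm : ∀ a, Measurable[R.alg (allDownSeeds n b m l k)] (T a) := fun a =>
    (Finset.measurable_fun_sum _ fun i _ => R.measurable_alg_downFactor
      (Set.subset_iUnion (fun i => Set.range (Seed.downIdx k i)) i) a).const_mul _
  have hT1 : ∀ a, ∫ ω, T a ω ∂P = 1 := fun a => by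
    simp only [hTdef]
    rw [integral_mean (hTi a)]
    simp only [integral_rand1Factor hl (fun j => R.measurable_downIdx k _ j)
      (fun j => R.law_downIdx k _ j)]
    simp [hn]
  have hTv : ∀ a, Var[T a; P] = rand1Omega d / (n * l) := fun a => by
    simp only [hTdef]
    rw [variance_mean (hTi a) fun i i' hi => ?_]
    · simp only [variance_rand1Factor hl (fun j => R.measurable_downIdx k _ j)
        (fun j => R.law_downIdx k _ j) (R.indepFun_downIdx k _)]
      simp
      field_simp
    · refine R.indepFun_of_disjoint ?_ (R.measurable_alg_downFactor subset_rfl a)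
        (R.measurable_alg_downFactor subset_rfl a)
      rw [Set.disjoint_left]
      rintro s ⟨r, rfl⟩ ⟨r', hr⟩
      simp at hr
      exact hi hr.1.symm
  have key := fun a => R.displacement_moment hp h k s.2 a γ
    (((n : ℝ)⁻¹ • ∑ i, (s.2 i - s.1)) a) (hT a) (hTm a) (hT1 a)
  have heq : ∀ a ω, ((n : ℝ)⁻¹ •
      ∑ i, ((stepMap G γ s (R.draws k ω)).2 i - (stepMap G γ s (R.draws k ω)).1)) a =
      (if R.coin k ω = true then 0 else 1) * (((n : ℝ)⁻¹ • ∑ i, (s.2 i - s.1)) a +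
        (T a ω - 1) * (-γ * gradOf G (R.draws k ω) s.2 a)) := fun a ω => by
    have h1 : ∀ i, ((stepMap G γ s (R.draws k ω)).2 i - (stepMap G γ s (R.draws k ω)).1) a =
      (if R.coin k ω = true then 0 else 1) * ((s.2 i - s.1) a +
        (rand1Factor (fun j => R.downIdx k i j ω) a - 1) * (-γ * gradOf G (R.draws k ω) s.2 a)) :=
      fun i => stepMap_sub_apply _ _ _ _ _ _
    have h2 : ((n : ℝ)⁻¹ • ∑ i, (s.2 i - s.1)) a = (n : ℝ)⁻¹ * ∑ i, (s.2 i - s.1) a := by simp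
    have h3 : ((n : ℝ)⁻¹ • ∑ i, ((stepMap G γ s (R.draws k ω)).2 i -
        (stepMap G γ s (R.draws k ω)).1)) a = (n : ℝ)⁻¹ *
          ∑ i, ((stepMap G γ s (R.draws k ω)).2 i - (stepMap G γ s (R.draws k ω)).1) a := by simp
    rw [h2, h3]
    simp only [h1, hTdef]
    rw [← Finset.mul_sum, Finset.sum_add_distrib, ← Finset.sum_mul, Finset.sum_sub_distrib]
    simp only [Finset.sum_const, Finset.card_univ, Fintype.card_fin, nsmul_eq_mul, mul_one]
    field_simp
  have hmem : ∀ a, MemLp (fun ω => ((n : ℝ)⁻¹ •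
      ∑ i, ((stepMap G γ s (R.draws k ω)).2 i - (stepMap G γ s (R.draws k ω)).1)) a) 2 P :=
    fun a => by simp only [heq]; exact (key a).1
  refine ⟨integrable_norm_sq_of_coord hmem, ?_⟩
  rw [integral_norm_sq_of_coord hmem, integral_norm_sq_of_coord (R.memLp_gradOf h k s.2),
    norm_sq_eq_sum]
  simp only [heq, (key _).2, hTv]
  simp only [Finset.mul_sum, ← Finset.sum_add_distrib]

end Randomness

/-! ### The Lyapunov function -/

/-- The Lyapunov function of the method. -/
def lyapunov {n d : ℕ} (f : Vec d → ℝ) (fstar α β : ℝ) (s : Vec d × (Fin n → Vec d)) : ℝ :=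
  f s.1 - fstar + α * ((n : ℝ)⁻¹ * ∑ i, ‖s.2 i - s.1‖ ^ 2) +
    β * ‖(n : ℝ)⁻¹ • ∑ i, (s.2 i - s.1)‖ ^ 2

theorem measurable_lyapunov {n d : ℕ} {f : Vec d → ℝ} (hf : Continuous f) (fstar α β : ℝ) :
    Measurable (lyapunov (n := n) f fstar α β) := by
  have : Continuous (lyapunov (n := n) f fstar α β) := by
    unfold lyapunov
    fun_prop
  exact this.measurable

theorem lyapunov_nonneg {n d : ℕ} {f : Vec d → ℝ} {fstar α β : ℝ} (hstar : ∀ x, fstar ≤ f x)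
    (hα : 0 ≤ α) (hβ : 0 ≤ β) (s : Vec d × (Fin n → Vec d)) : 0 ≤ lyapunov f fstar α β s := by
  have := hstar s.1
  have : 0 ≤ f s.1 - fstar := by linarith
  unfold lyapunov
  positivity

/-- The functional inequality with as many shifts as workers, the shifts being x_i - x. -/
theorem norm_meanGradient_sub_sq_le {n d : ℕ} [NeZero n] {f : Vec d → ℝ} {LA LB : ℝ}
    (h : FunctionalInequality f LA LB) (s : Vec d × (Fin n → Vec d)) :
    ‖Randomness.meanGradient f s.2 - gradient f s.1‖ ^ 2 ≤
      LA ^ 2 * ((n : ℝ)⁻¹ * ∑ i, ‖s.2 i - s.1‖ ^ 2) +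
        LB ^ 2 * ‖(n : ℝ)⁻¹ • ∑ i, (s.2 i - s.1)‖ ^ 2 := by
  have hn : (n : ℝ) ≠ 0 := by exact_mod_cast NeZero.ne n
  have h1 := h.2.2 n NeZero.one_le s.1 fun i => s.2 i - s.1
  simp only [add_sub_cancel] at h1
  refine le_trans (le_of_eq ?_) h1
  congr 2
  rw [Finset.sum_sub_distrib, smul_sub, Randomness.meanGradient]
  simp only [Finset.sum_const, Finset.card_univ, Fintype.card_fin]
  rw [← Nat.cast_smul_eq_nsmul ℝ, smul_smul, inv_mul_cancel₀ hn, one_smul]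

theorem mean_norm_gradient_sq_le {n d : ℕ} [NeZero n] {f : Vec d → ℝ} {L : ℝ}
    (h : IsLSmooth f L) (s : Vec d × (Fin n → Vec d)) :
    (n : ℝ)⁻¹ * ∑ i, ‖gradient f (s.2 i)‖ ^ 2 ≤
      2 * ‖gradient f s.1‖ ^ 2 + 2 * L ^ 2 * ((n : ℝ)⁻¹ * ∑ i, ‖s.2 i - s.1‖ ^ 2) := by
  have hn : (n : ℝ) ≠ 0 := by exact_mod_cast NeZero.ne n
  have h1 : ∀ i, ‖gradient f (s.2 i)‖ ^ 2 ≤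
      2 * ‖gradient f s.1‖ ^ 2 + 2 * L ^ 2 * ‖s.2 i - s.1‖ ^ 2 := by
    intro i
    have h2 := h.2 (s.2 i) s.1
    have h3 : ‖gradient f (s.2 i)‖ ≤ ‖gradient f s.1‖ + L * ‖s.2 i - s.1‖ := by
      have := norm_add_le (gradient f s.1) (gradient f (s.2 i) - gradient f s.1)
      rw [add_sub_cancel] at this
      linarith
    have h4 := pow_le_pow_left₀ (norm_nonneg _) h3 2
    nlinarith [sq_nonneg (‖gradient f s.1‖ - L * ‖s.2 i - s.1‖)]
  calc (n : ℝ)⁻¹ * ∑ i, ‖gradient f (s.2 i)‖ ^ 2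
      ≤ (n : ℝ)⁻¹ * ∑ i, (2 * ‖gradient f s.1‖ ^ 2 + 2 * L ^ 2 * ‖s.2 i - s.1‖ ^ 2) := by
        gcongr with i; exact h1 i
    _ = _ := by
        rw [Finset.sum_add_distrib, ← Finset.mul_sum, ← Finset.mul_sum]
        simp
        field_simp

/-- The arithmetic of one step. -/
theorem one_step_arith {γ L LA LB α β p w q wl wnl S ε F N2 V W E A I : ℝ} (hγ : 0 < γ)
    (hL : 0 ≤ L) (hα : 0 ≤ α) (hβ : 0 ≤ β) (hp : p ∈ Set.Icc (0 : ℝ) 1) (hw0 : 0 ≤ w)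
    (hwl : 0 ≤ wl) (hwnl : 0 ≤ wnl)
    (hq : q = L / 2 * γ ^ 2 + γ ^ 2 * (α * wl + β * wnl)) (hq' : q ≤ 5 / 36 * γ)
    (hw : w ≤ 1 / 8) (hε : 0 ≤ ε) (hS : S ≤ ε / 4)
    (hα' : γ / 2 * LA ^ 2 + γ * w * L ^ 2 ≤ p * α) (hβ' : γ / 2 * LB ^ 2 ≤ p * β)
    (hF : 0 ≤ F) (hN2 : 0 ≤ N2) (hV : 0 ≤ V) (hW : 0 ≤ W) (hE0 : 0 ≤ E)
    (hE : E ≤ N2 + w * A + S) (hA : A ≤ 2 * F + 2 * L ^ 2 * V)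
    (hI : F + N2 - (LA ^ 2 * V + LB ^ 2 * W) ≤ 2 * I) :
    -γ * I + L / 2 * (γ ^ 2 * E) + α * ((1 - p) * (V + wl * (γ ^ 2 * E))) +
      β * ((1 - p) * (W + wnl * (γ ^ 2 * E))) + 67 / 144 * γ * F ≤
      α * V + β * W + 5 / 144 * (γ * ε) := by
  have hq0 : 0 ≤ q := by rw [hq]; positivity
  have h1 : (1 - p) * (α * (wl * (γ ^ 2 * E)) + β * (wnl * (γ ^ 2 * E))) ≤
      α * (wl * (γ ^ 2 * E)) + β * (wnl * (γ ^ 2 * E)) :=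
    mul_le_of_le_one_left (by positivity) (by linarith [hp.1])
  have h2 : L / 2 * (γ ^ 2 * E) + (α * (wl * (γ ^ 2 * E)) + β * (wnl * (γ ^ 2 * E))) = q * E := by
    rw [hq]; ring
  -- Here q collects all coefficients of E‖g‖², from the descent lemma and from both displacement
  -- recursions.
  have h3 : q * E ≤ q * N2 + q * w * A + q * S := by nlinarith
  have h4 : q * N2 ≤ γ / 2 * N2 := by gcongr; linarith
  have h5 : q * S ≤ 5 / 144 * (γ * ε) := by
    calc q * S ≤ q * (ε / 4) := by gcongr
      _ ≤ 5 / 36 * γ * (ε / 4) := by gcongr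
      _ = _ := by ring
  have h6 : q * w * A ≤ q * w * (2 * F) + q * w * (2 * L ^ 2 * V) := by
    rw [← mul_add]; gcongr
  -- This loss turns the coefficient γ/2 of F, supplied by polarization, into 67/144 γ = (72 -
  -- 5)/144 γ.
  have h7 : q * w * (2 * F) ≤ 5 / 144 * γ * F := by
    calc q * w * (2 * F) ≤ 5 / 36 * γ * (1 / 8) * (2 * F) := by gcongr
      _ = _ := by ring
  -- The drift part of the compression noise is paid by the term γ w L² reserved in p α.
  have h8 : q * w * (2 * L ^ 2 * V) ≤ γ * w * L ^ 2 * V := by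
    calc q * w * (2 * L ^ 2 * V) ≤ (γ / 2) * w * (2 * L ^ 2 * V) := by gcongr; linarith
      _ = _ := by ring
  have h9 := mul_le_mul_of_nonneg_right hα' hV
  have h10 := mul_le_mul_of_nonneg_right hβ' hW
  have h11 := mul_le_mul_of_nonneg_left hI (by positivity : 0 ≤ γ / 2)
  nlinarith

namespace Randomness

variable {Ω : Type v} [MeasurableSpace Ω] {P : Measure Ω} [IsProbabilityMeasure P] {Ξ : Type u}
  [MeasurableSpace Ξ] {D : Measure Ξ} [IsProbabilityMeasure D] {n d b m l : ℕ} [NeZero n]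
  [NeZero d] {p : ℝ} (R : Randomness P D n d b m l p) {f : Vec d → ℝ} {G : Vec d → Ξ → Vec d}
  {σ : ℝ}

theorem rand1Omega_nonneg (d : ℕ) [NeZero d] : 0 ≤ rand1Omega d := by
  have : (1 : ℝ) ≤ d := by exact_mod_cast NeZero.one_le
  unfold rand1Omega; linarith

theorem one_step {fstar L LA LB γ α β ε : ℝ} (hb : b ≠ 0) (hm : m ≠ 0) (hl : l ≠ 0)
    (hp : p ∈ Set.Icc (0 : ℝ) 1) (hf : IsLSmooth f L) (hstar : ∀ x, fstar ≤ f x)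
    (hfun : FunctionalInequality f LA LB) (h : IsStochasticGradient f G D σ) (hγ : 0 < γ)
    (hα : 0 ≤ α) (hβ : 0 ≤ β) (hε : 0 ≤ ε)
    (hq : L / 2 * γ ^ 2 + γ ^ 2 * (α * (rand1Omega d / l) + β * (rand1Omega d / (n * l))) ≤
      5 / 36 * γ)
    (hw : rand1Omega d / (n * m) ≤ 1 / 8)
    (hS : (rand1Omega d / m + 1) * (σ ^ 2 / (n * b)) ≤ ε / 4)
    (hα' : γ / 2 * LA ^ 2 + γ * (rand1Omega d / (n * m)) * L ^ 2 ≤ p * α)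
    (hβ' : γ / 2 * LB ^ 2 ≤ p * β) (k : ℕ) (s : Vec d × (Fin n → Vec d)) :
    ∫⁻ ω, ENNReal.ofReal (lyapunov f fstar α β (stepMap G γ s (R.draws k ω))) ∂P +
        ENNReal.ofReal (67 / 144 * γ * ‖gradient f s.1‖ ^ 2) ≤
      ENNReal.ofReal (lyapunov f fstar α β s) + ENNReal.ofReal (5 / 144 * (γ * ε)) := by
  have hd := rand1Omega_nonneg d
  have hΦ0 := lyapunov_nonneg (n := n) hstar hα hβ
  set g : Ω → Vec d := fun ω => gradOf G (R.draws k ω) s.2 with hg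
  set v : Fin n → Ω → ℝ := fun i ω =>
    ‖(stepMap G γ s (R.draws k ω)).2 i - (stepMap G γ s (R.draws k ω)).1‖ ^ 2 with hv
  set w : Ω → ℝ := fun ω => ‖(n : ℝ)⁻¹ •
    ∑ i, ((stepMap G γ s (R.draws k ω)).2 i - (stepMap G γ s (R.draws k ω)).1)‖ ^ 2 with hwdef
  have hgc := R.memLp_gradOf h k s.2
  have hvi : ∀ i, Integrable (v i) P := fun i => (R.displacement_worker hp hl h k s γ i).1
  have hve : ∀ i, ∫ ω, v i ω ∂P = _ := fun i => (R.displacement_worker hp hl h k s γ i).2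
  have hwi : Integrable w P := (R.displacement_mean hp hl h k s γ).1
  have hwe : ∫ ω, w ω ∂P = _ := (R.displacement_mean hp hl h k s γ).2
  have hgi : Integrable (fun ω => ‖g ω‖ ^ 2) P := integrable_norm_sq_of_coord hgc
  have hii : Integrable (fun ω => inner ℝ (gradient f s.1) (g ω)) P :=
    integrable_inner_of_coord hgc _
  have hie : ∫ ω, inner ℝ (gradient f s.1) (g ω) ∂P = inner ℝ (gradient f s.1) (meanGradient f s.2) :=
    integral_inner_of_coord hgc _ (R.integral_gradOf hb hm h k s.2)
  have hge : ∫ ω, ‖g ω‖ ^ 2 ∂P ≤ _ := R.integral_norm_gradOf_sq_le hb hm h k s.2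
  -- Ψ is Φ⁺ with f(x⁺) replaced by its quadratic upper bound, so its integral is explicit in the
  -- computed moments.
  set Ψ : Ω → ℝ := fun ω => f s.1 - fstar + -γ * inner ℝ (gradient f s.1) (g ω) +
    L / 2 * (γ ^ 2 * ‖g ω‖ ^ 2) + α * ((n : ℝ)⁻¹ * ∑ i, v i ω) + β * w ω with hΨ
  have hle : ∀ ω, lyapunov f fstar α β (stepMap G γ s (R.draws k ω)) ≤ Ψ ω := fun ω => by
    have h1 := hf.le_quadratic s.1 (-γ • g ω)
    rw [real_inner_smul_right, norm_smul, mul_pow, Real.norm_eq_abs, sq_abs, neg_sq] at h1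
    have h2 : (stepMap G γ s (R.draws k ω)).1 = s.1 + -γ • g ω := by
      simp [stepMap, hg, sub_eq_add_neg]
    simp only [lyapunov, hΨ, hv, hwdef]
    rw [← h2] at h1
    linarith
  have i1 : Integrable (fun ω => f s.1 - fstar + -γ * inner ℝ (gradient f s.1) (g ω)) P :=
    (integrable_const _).add (hii.const_mul _)
  have i2 : Integrable (fun ω => L / 2 * (γ ^ 2 * ‖g ω‖ ^ 2)) P :=
    (hgi.const_mul _).const_mul _
  have i3 : Integrable (fun ω => α * ((n : ℝ)⁻¹ * ∑ i, v i ω)) P :=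
    ((integrable_finsetSum _ fun i _ => hvi i).const_mul _).const_mul _
  have i4 : Integrable (fun ω => β * w ω) P := hwi.const_mul _
  have i12 : Integrable (fun ω => f s.1 - fstar + -γ * inner ℝ (gradient f s.1) (g ω) +
      L / 2 * (γ ^ 2 * ‖g ω‖ ^ 2)) P := i1.add i2
  have i123 : Integrable (fun ω => f s.1 - fstar + -γ * inner ℝ (gradient f s.1) (g ω) +
      L / 2 * (γ ^ 2 * ‖g ω‖ ^ 2) + α * ((n : ℝ)⁻¹ * ∑ i, v i ω)) P := i12.add i3
  have hΨi : Integrable Ψ P := i123.add i4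
  have hΨe : ∫ ω, Ψ ω ∂P = f s.1 - fstar + -γ * ∫ ω, inner ℝ (gradient f s.1) (g ω) ∂P +
      L / 2 * (γ ^ 2 * ∫ ω, ‖g ω‖ ^ 2 ∂P) + α * ((n : ℝ)⁻¹ * ∑ i, ∫ ω, v i ω ∂P) +
      β * ∫ ω, w ω ∂P := by
    simp only [hΨ]
    rw [integral_add i123 i4, integral_add i12 i3, integral_add i1 i2,
      integral_add (integrable_const _) (hii.const_mul _)]
    simp only [integral_const_mul]
    rw [integral_finsetSum _ fun i _ => hvi i]
    simp
  have hmain : ∫ ω, Ψ ω ∂P + 67 / 144 * γ * ‖gradient f s.1‖ ^ 2 ≤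
      lyapunov f fstar α β s + 5 / 144 * (γ * ε) := by
    have hn : (n : ℝ) ≠ 0 := by exact_mod_cast NeZero.ne n
    -- Polarization: 2⟨a, b⟩ = ‖a‖² + ‖b‖² - ‖b - a‖², the last term being bounded by the functional
    -- inequality.
    have hI : ‖gradient f s.1‖ ^ 2 + ‖meanGradient f s.2‖ ^ 2 -
        (LA ^ 2 * ((n : ℝ)⁻¹ * ∑ i, ‖s.2 i - s.1‖ ^ 2) +
        LB ^ 2 * ‖(n : ℝ)⁻¹ • ∑ i, (s.2 i - s.1)‖ ^ 2) ≤
        2 * inner ℝ (gradient f s.1) (meanGradient f s.2) := by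
      have h1 := norm_meanGradient_sub_sq_le hfun s
      rw [norm_sub_sq_real, real_inner_comm] at h1
      linarith
    have h2 := one_step_arith (V := (n : ℝ)⁻¹ * ∑ i, ‖s.2 i - s.1‖ ^ 2)
      (W := ‖(n : ℝ)⁻¹ • ∑ i, (s.2 i - s.1)‖ ^ 2) (F := ‖gradient f s.1‖ ^ 2)
      hγ hf.nonneg hα hβ hp (by positivity) (by positivity) (by positivity) rfl hq hw hε hS hα' hβ'
      (by positivity) (by positivity) (by positivity) (by positivity)
      (integral_nonneg fun ω => by positivity) hge (mean_norm_gradient_sq_le hf s) hI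
    rw [hΨe, hie, hwe]
    simp only [hve]
    rw [← Finset.mul_sum, Finset.sum_add_distrib]
    simp only [Finset.sum_const, Finset.card_univ, Fintype.card_fin, nsmul_eq_mul]
    have h3 : ∀ c y z : ℝ, (n : ℝ)⁻¹ * (c * (y + n * z)) = c * ((n : ℝ)⁻¹ * y + z) := by
      intro c y z; field_simp
    rw [h3]
    simp only [lyapunov]
    linarith
  calc _ ≤ ∫⁻ ω, ENNReal.ofReal (Ψ ω) ∂P +
        ENNReal.ofReal (67 / 144 * γ * ‖gradient f s.1‖ ^ 2) := by
        gcongr with ω; exact hle ω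
    _ = ENNReal.ofReal (∫ ω, Ψ ω ∂P + 67 / 144 * γ * ‖gradient f s.1‖ ^ 2) := by
        rw [← ofReal_integral_eq_lintegral_ofReal hΨi
          (ae_of_all _ fun ω => (hΦ0 _).trans (hle ω)), ENNReal.ofReal_add _ (by positivity)]
        exact integral_nonneg fun ω => (hΦ0 _).trans (hle ω)
    _ ≤ _ := by
        rw [← ENNReal.ofReal_add (hΦ0 s) (by positivity)]
        exact ENNReal.ofReal_le_ofReal hmain

/-- Summation of the expected decrease over the iterations. -/
theorem sum_le_of_step (hG : Measurable (Function.uncurry G)) (γ : ℝ) (x0 : Vec d)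
    {Φ F : Vec d × (Fin n → Vec d) → ENNReal} (hΦ : Measurable Φ) (hF : Measurable F)
    {c : ENNReal}
    (hstep : ∀ k s, ∫⁻ ω, Φ (stepMap G γ s (R.draws k ω)) ∂P + F s ≤ Φ s + c) (K : ℕ) :
    ∑ k ∈ Finset.range K, ∫⁻ ω, F (state R G γ x0 ω k) ∂P ≤
      Φ (x0, fun _ => x0) + K * c := by
  have hs := R.measurable_state hG γ x0
  have key : ∀ k, ∫⁻ ω, Φ (state R G γ x0 ω (k + 1)) ∂P + ∫⁻ ω, F (state R G γ x0 ω k) ∂P ≤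
      ∫⁻ ω, Φ (state R G γ x0 ω k) ∂P + c := by
    intro k
    simp only [state_succ]
    rw [lintegral_indepFun (hs k) (R.measurable_draws k) (R.indepFun_state_draws hG γ x0 k)
      (F := fun s y => Φ (stepMap G γ s y)) (hΦ.comp (measurable_stepMap hG γ)),
      ← lintegral_add_right _ (show Measurable fun ω => F (state R G γ x0 ω k) from hF.comp (hs k))]
    calc _ ≤ ∫⁻ ω, (Φ (state R G γ x0 ω k) + c) ∂P := lintegral_mono fun ω => hstep k _
      _ = _ := by rw [lintegral_add_right _ measurable_const]; simp
  -- The induction needs the remaining expectation of Φ on the left; it is dropped at the end.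
  suffices h : ∑ k ∈ Finset.range K, ∫⁻ ω, F (state R G γ x0 ω k) ∂P +
      ∫⁻ ω, Φ (state R G γ x0 ω K) ∂P ≤ Φ (x0, fun _ => x0) + K * c from
    le_self_add.trans h
  induction K with
  | zero => simp [state]
  | succ K ih =>
    rw [Finset.sum_range_succ, add_assoc, add_comm (∫⁻ ω, F (state R G γ x0 ω K) ∂P)]
    calc _ ≤ ∑ k ∈ Finset.range K, ∫⁻ ω, F (state R G γ x0 ω k) ∂P +
          (∫⁻ ω, Φ (state R G γ x0 ω K) ∂P + c) := add_le_add le_rfl (key K)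
      _ ≤ Φ (x0, fun _ => x0) + K * c + c := by rw [← add_assoc]; gcongr
      _ = _ := by push_cast; ring

/-- The uniform index turns the expectation into the average over the N + 1 points x⁰, …, x^N.
Integrability follows from the finiteness of the bound. -/
theorem isEpsStationary_output (hG : Measurable (Function.uncurry G)) {γ ε : ℝ} {x0 : Vec d}
    (hf : Continuous (gradient f)) (hε : 0 ≤ ε) (N : ℕ)
    (hsum : ∑ k ∈ Finset.range (N + 1),
      ∫⁻ ω, ENNReal.ofReal (‖gradient f (state R G γ x0 ω k).1‖ ^ 2) ∂P ≤
        ENNReal.ofReal ((N + 1) * ε)) :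
    IsEpsStationary (P.prod (uniformFin (N + 1))) f ε (output R G γ x0 N) := by
  have hm : Measurable (output R G γ x0 N) :=
    measurable_from_prod_countable_left fun k => (R.measurable_state hG γ x0 k).fst
  have hm2 : Measurable fun z => ‖gradient f (output R G γ x0 N z)‖ ^ 2 :=
    ((hf.measurable.comp hm).norm).pow_const 2
  have hlint : ∫⁻ z, ENNReal.ofReal (‖gradient f (output R G γ x0 N z)‖ ^ 2)
      ∂(P.prod (uniformFin (N + 1))) ≤ ENNReal.ofReal ε := by
    rw [lintegral_prod_symm _ hm2.ennreal_ofReal.aemeasurable, lintegral_fintype]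
    simp only [uniformFin_singleton, output]
    rw [← Finset.sum_mul, Fin.sum_univ_eq_sum_range
      (fun k => ∫⁻ ω, ENNReal.ofReal (‖gradient f (state R G γ x0 ω k).1‖ ^ 2) ∂P)]
    calc _ ≤ ENNReal.ofReal ((N + 1) * ε) * ((N + 1 : ℕ) : ENNReal)⁻¹ := by gcongr
      _ = _ := by
        rw [ENNReal.ofReal_mul (by positivity), mul_comm, ← mul_assoc]
        have : ENNReal.ofReal ((N : ℝ) + 1) = ((N + 1 : ℕ) : ENNReal) := by
          rw [← ENNReal.ofReal_natCast]; push_cast; rfl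
        rw [this, ENNReal.inv_mul_cancel (by simp) (ENNReal.natCast_ne_top _), one_mul]
  refine ⟨hm, ⟨hm2.aestronglyMeasurable, ?_⟩, ?_⟩
  · rw [hasFiniteIntegral_iff_ofReal (ae_of_all _ fun z => by positivity)]
    exact hlint.trans_lt ENNReal.ofReal_lt_top
  · rw [integral_eq_lintegral_of_nonneg_ae (ae_of_all _ fun z => by positivity)
      hm2.aestronglyMeasurable]
    exact ENNReal.toReal_le_of_le_ofReal hε hlint

/-! ### Duration -/

/-- The l κ seconds of compressed downlink are charged even when the coin shows 1, so that the bound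
is affine in the coin and its expectation needs only p. -/
theorem iterationTime_le {h τ κ : ℝ} (hκ : 0 ≤ κ) (T : Timing Ω n d b m l h τ κ) (k : ℕ) (ω : Ω) :
    iterationTime R T k ω ≤
      b * h + m * τ + l * κ + d * κ * (if R.coin k ω = true then 1 else 0) := by
  unfold iterationTime
  have h1 : (⨆ i, (∑ r, T.compute k i r ω + ∑ j, T.upload k i j ω)) ≤ b * h + m * τ := by
    refine ciSup_le fun i => ?_
    have h2 := Finset.sum_le_card_nsmul Finset.univ (fun r => T.compute k i r ω) h
      fun r _ => (T.compute_mem k i r ω).2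
    have h3 := Finset.sum_le_card_nsmul Finset.univ (fun r => T.upload k i r ω) τ
      fun r _ => (T.upload_mem k i r ω).2
    simp at h2 h3
    linarith
  have h4 : (⨆ i, (if R.coin k ω = true then T.sync k i ω else ∑ j, T.download k i j ω)) ≤
      l * κ + d * κ * (if R.coin k ω = true then 1 else 0) := by
    refine ciSup_le fun i => ?_
    have h5 : (0 : ℝ) ≤ l * κ := by positivity
    split_ifs
    · linarith [(T.sync_mem k i ω).2]
    · have h3 := Finset.sum_le_card_nsmul Finset.univ (fun r => T.download k i r ω) κ
        fun r _ => (T.download_mem k i r ω).2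
      simp at h3
      linarith
  linarith

theorem iterationTime_nonneg {h τ κ : ℝ} (T : Timing Ω n d b m l h τ κ) (k : ℕ) (ω : Ω) :
    0 ≤ iterationTime R T k ω := by
  unfold iterationTime
  refine add_nonneg (Real.iSup_nonneg fun i => ?_) (Real.iSup_nonneg fun i => ?_)
  · exact add_nonneg (Finset.sum_nonneg fun r _ => (T.compute_mem k i r ω).1)
      (Finset.sum_nonneg fun r _ => (T.upload_mem k i r ω).1)
  · split_ifs
    · exact (T.sync_mem k i ω).1
    · exact Finset.sum_nonneg fun r _ => (T.download_mem k i r ω).1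

theorem measurable_iterationTime {h τ κ : ℝ} (T : Timing Ω n d b m l h τ κ) (k : ℕ) :
    Measurable (iterationTime R T k) := by
  unfold iterationTime
  refine Measurable.add (Measurable.iSup fun i => ?_) (Measurable.iSup fun i => ?_)
  · exact (Finset.measurable_fun_sum _ fun r _ => T.measurable_compute k i r).add
      (Finset.measurable_fun_sum _ fun r _ => T.measurable_upload k i r)
  · exact Measurable.ite (measurableSet_eq_fun (R.measurable_coin k) measurable_const)
      (T.measurable_sync k i) (Finset.measurable_fun_sum _ fun r _ => T.measurable_download k i r)

theorem totalTime_bound {h τ κ : ℝ} (hp : p ∈ Set.Icc (0 : ℝ) 1) (hκ : 0 ≤ κ)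
    (T : Timing Ω n d b m l h τ κ) (N : ℕ) :
    Integrable (totalTime R T N) P ∧
      ∫ ω, totalTime R T N ω ∂P ≤ N * (b * h + m * τ + l * κ + d * κ * p) := by
  have hc : ∀ k, Integrable (fun ω => if R.coin k ω = true then (1 : ℝ) else 0) P := fun k =>
    (memLp_of_fintype (R.measurable_coin k) fun c => if c = true then (1 : ℝ) else 0).integrable
      one_le_two
  have hb : ∀ k, Integrable (fun ω => (b * h + m * τ + l * κ : ℝ) +
      d * κ * (if R.coin k ω = true then 1 else 0)) P := fun k =>
    (integrable_const _).add ((hc k).const_mul _)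
  have hi : ∀ k, Integrable (iterationTime R T k) P := fun k =>
    (hb k).mono' (R.measurable_iterationTime T k).aestronglyMeasurable (ae_of_all _ fun ω => by
      rw [Real.norm_of_nonneg (R.iterationTime_nonneg T k ω)]
      exact R.iterationTime_le hκ T k ω)
  refine ⟨integrable_finsetSum _ fun k _ => hi k, ?_⟩
  unfold totalTime
  rw [integral_finsetSum _ fun k _ => hi k]
  have h1 : ∀ k, ∫ ω, iterationTime R T k ω ∂P ≤ b * h + m * τ + l * κ + d * κ * p := fun k => by
    refine (integral_mono (hi k) (hb k) (R.iterationTime_le hκ T k)).trans (le_of_eq ?_)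
    rw [integral_add (integrable_const _) ((hc k).const_mul _), integral_const_mul,
      R.integral_coin hp k fun c => if c = true then (1 : ℝ) else 0]
    simp
  refine (Finset.sum_le_sum fun k _ => h1 k).trans (le_of_eq ?_)
  rw [Finset.sum_const, Finset.card_range, nsmul_eq_mul]

end Randomness

/-! ### The parameters -/

/-- Rounding down a number that is at least 1 loses at most a factor 2. -/
theorem floor_div_bounds {h t : ℝ} (hh : 0 < h) (ht : h ≤ t) {b : ℕ} (hb : b = ⌊t / h⌋₊) :
    1 ≤ b ∧ b * h ≤ t ∧ t ≤ 2 * (b * h) := by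
  have h1 : 1 ≤ t / h := (one_le_div hh).2 ht
  have h2 : 1 ≤ b := by rw [hb]; exact Nat.one_le_floor_iff _ |>.2 h1
  have h3 : (b : ℝ) ≤ t / h := by rw [hb]; exact Nat.floor_le (by linarith)
  have h4 : t / h < b + 1 := by rw [hb]; exact Nat.lt_floor_add_one _
  have h5 : (1 : ℝ) ≤ b := by exact_mod_cast h2
  refine ⟨h2, (le_div_iff₀ hh).1 h3, ?_⟩
  have h6 := (div_lt_iff₀ hh).1 h4
  nlinarith

/-- The maximum in the time complexity. -/
def timeScale (n d : ℕ) (h τ κ σ ε : ℝ) : ℝ :=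
  h ⊔ τ ⊔ κ ⊔ (d * κ / √(n : ℝ)) ⊔ (d * τ / n) ⊔ (d ^ 3 * τ * κ ^ 2 / n) ^ (1 / 3 : ℝ) ⊔
      √(d * σ ^ 2 * h * τ / (n * ε)) ⊔ (σ ^ 2 * h / (n * ε))

theorem timeRate_eq (n d : ℕ) (h τ κ σ ε L LA LB Δ : ℝ) :
    timeRate n d h τ κ σ ε L LA LB Δ =
      timeScale n d h τ κ σ ε * (lMax L LA LB * Δ / ε) + d * κ * LA * Δ / ε := rfl

theorem timeBudget_le {n d : ℕ} {h τ κ σ ε : ℝ} (hh : 0 < h) (hτ : 0 < τ)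
    (hκ : 0 < κ) :
    timeBudget n d h τ κ σ ε ≤ 16 * timeScale n d h τ κ σ ε := by
  have h1 : h ≤ timeScale n d h τ κ σ ε := by simp [timeScale]
  have h2 : τ ≤ timeScale n d h τ κ σ ε := by simp [timeScale]
  have h3 : κ ≤ timeScale n d h τ κ σ ε := by simp [timeScale]
  have h4 : d * κ / √(n : ℝ) ≤ timeScale n d h τ κ σ ε := by simp [timeScale]
  have h5 : d * τ / n ≤ timeScale n d h τ κ σ ε := by simp [timeScale]
  have h6 : (d ^ 3 * τ * κ ^ 2 / n) ^ (1 / 3 : ℝ) ≤ timeScale n d h τ κ σ ε := by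
    simp [timeScale]
  have h7 : √(d * σ ^ 2 * h * τ / (n * ε)) ≤ timeScale n d h τ κ σ ε := by simp [timeScale]
  have h8 : σ ^ 2 * h / (n * ε) ≤ timeScale n d h τ κ σ ε := by simp [timeScale]
  have h0 : 0 < timeScale n d h τ κ σ ε := hh.trans_le h1
  refine sup_le (sup_le (sup_le (sup_le (sup_le (sup_le (sup_le ?_ ?_) ?_) ?_) ?_) ?_) ?_) ?_
  · linarith
  · linarith
  · linarith
  · have : 16 * rand1Omega d * τ / n ≤ 16 * (d * τ / n) := by
      rw [mul_assoc, mul_div_assoc]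
      gcongr
      unfold rand1Omega; linarith
    linarith
  · have : 16 * σ ^ 2 * h / (n * ε) = 16 * (σ ^ 2 * h / (n * ε)) := by ring
    linarith
  · have : 2 * d * κ / √(n : ℝ) = 2 * (d * κ / √(n : ℝ)) := by ring
    linarith
  · have e : (32 * d * σ ^ 2 * h * τ / (n * ε) : ℝ) = 32 * (d * σ ^ 2 * h * τ / (n * ε)) := by ring
    rw [e, Real.sqrt_mul (by norm_num)]
    have h9 : √(32 : ℝ) ≤ 16 := by
      rw [Real.sqrt_le_left (by norm_num)]; norm_num
    gcongr
  · have e : (8 * d ^ 3 * τ * κ ^ 2 / n : ℝ) = 2 ^ (3 : ℝ) * (d ^ 3 * τ * κ ^ 2 / n) := by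
      norm_num; ring
    rw [e, Real.mul_rpow (by positivity) (by positivity), ← Real.rpow_mul (by norm_num)]
    norm_num at h6 ⊢
    linarith

/-- What the choice of the time budget gives for the numbers of samples and messages. -/
theorem budget_bounds {n d : ℕ} [NeZero n] [NeZero d] {h τ κ σ ε t : ℝ} {b m l : ℕ} (hh : 0 < h)
    (hτ : 0 < τ) (hκ : 0 < κ) (hε : 0 < ε) (ht : t = timeBudget n d h τ κ σ ε)
    (hb : b = ⌊t / h⌋₊) (hm : m = ⌊t / τ⌋₊) (hl : l = ⌊t / κ⌋₊) :
    8 * rand1Omega d ≤ n * m ∧ 8 * σ ^ 2 ≤ n * b * ε ∧ 8 * (d * σ ^ 2) ≤ n * m * b * ε ∧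
      (d : ℝ) ^ 2 ≤ n * l ^ 2 ∧ (d : ℝ) ^ 3 ≤ n * m * l ^ 2 := by
  have hn : (0 : ℝ) < n := by exact_mod_cast NeZero.pos n
  have hd : (0 : ℝ) < d := by exact_mod_cast NeZero.pos d
  have t1 : h ≤ t := by simp [ht, timeBudget]
  have t2 : τ ≤ t := by simp [ht, timeBudget]
  have t3 : κ ≤ t := by simp [ht, timeBudget]
  have t4 : 16 * rand1Omega d * τ / n ≤ t := by simp [ht, timeBudget]
  have t5 : 16 * σ ^ 2 * h / (n * ε) ≤ t := by simp [ht, timeBudget]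
  have t6 : 2 * d * κ / √(n : ℝ) ≤ t := by simp [ht, timeBudget]
  have t7 : √(32 * d * σ ^ 2 * h * τ / (n * ε)) ≤ t := by simp [ht, timeBudget]
  have t8 : (8 * d ^ 3 * τ * κ ^ 2 / n) ^ (1 / 3 : ℝ) ≤ t := by simp [ht, timeBudget]
  obtain ⟨-, -, b3⟩ := floor_div_bounds hh t1 hb
  obtain ⟨-, -, m3⟩ := floor_div_bounds hτ t2 hm
  obtain ⟨-, -, l3⟩ := floor_div_bounds hκ t3 hl
  have t0 : 0 < t := hh.trans_le t1
  -- The constants in t pay for the rounding t ≤ 2bh, t ≤ 2mτ, t ≤ 2lκ: a factor 2 for each rounded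
  -- quantity, hence 4 = 2·2 under the square root and 8 = 2³ under the cube root.
  refine ⟨?_, ?_, ?_, ?_, ?_⟩
  · rw [div_le_iff₀ hn] at t4
    refine le_of_mul_le_mul_right ?_ hτ
    nlinarith
  · rw [div_le_iff₀ (by positivity)] at t5
    have := mul_le_mul_of_nonneg_right b3 (by positivity : 0 ≤ n * ε)
    refine le_of_mul_le_mul_right ?_ hh
    nlinarith
  · have e := (Real.sqrt_le_left t0.le).1 t7
    rw [div_le_iff₀ (by positivity)] at e
    have e2 : t ^ 2 ≤ 2 * (b * h) * (2 * (m * τ)) := by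
      rw [sq]; exact mul_le_mul b3 m3 t0.le (by positivity)
    have e3 := mul_le_mul_of_nonneg_right e2 (by positivity : 0 ≤ n * ε)
    refine le_of_mul_le_mul_right ?_ (by positivity : 0 < 4 * (h * τ))
    nlinarith
  · rw [div_le_iff₀ (by positivity)] at t6
    have e : (d : ℝ) ≤ l * √n := by
      have := mul_le_mul_of_nonneg_right l3 (Real.sqrt_nonneg n)
      refine le_of_mul_le_mul_right ?_ (by positivity : 0 < 2 * κ)
      nlinarith
    have e2 := pow_le_pow_left₀ hd.le e 2
    rw [mul_pow, Real.sq_sqrt hn.le] at e2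
    linarith
  · have e := pow_le_pow_left₀ (by positivity) t8 3
    rw [← Real.rpow_natCast, ← Real.rpow_mul (by positivity)] at e
    norm_num at e
    rw [div_le_iff₀ hn] at e
    have e2 : t ^ 3 ≤ (2 * (l * κ)) ^ 2 * (2 * (m * τ)) := by
      rw [pow_succ]
      exact mul_le_mul (pow_le_pow_left₀ t0.le l3 2) m3 t0.le (by positivity)
    have e3 := mul_le_mul_of_nonneg_right e2 hn.le
    refine le_of_mul_le_mul_right ?_ (by positivity : 0 < 8 * (τ * κ ^ 2))
    nlinarith

theorem sqrt_mul_div_sqrt_le {A B C : ℝ} (hB : 0 ≤ B) (hC : 0 < C) (h : A ≤ C) :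
    √A * B / √C ≤ B := by
  rw [div_le_iff₀ (Real.sqrt_pos.2 hC), mul_comm]
  gcongr

/-- Each term of the maximum M obeys γ · term ≤ 1/6; squaring removes the roots and gives 1/36. -/
theorem sq_mul_div_le_of_scale {A B C γ M : ℝ} (hA : 0 ≤ A) (hB : 0 ≤ B) (hC : 0 < C)
    (hγ : 0 < γ) (h : √A * B / √C ≤ M) (hM : γ * M ≤ 1 / 6) :
    γ ^ 2 * (A * B ^ 2 / C) ≤ 1 / 36 := by
  have h1 : γ * (√A * B / √C) ≤ 1 / 6 := (by gcongr : γ * (√A * B / √C) ≤ γ * M).trans hM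
  have h2 := pow_le_pow_left₀ (by positivity) h1 2
  rw [mul_pow, div_pow, mul_pow, Real.sq_sqrt hA, Real.sq_sqrt hC.le] at h2
  norm_num at h2 ⊢
  exact h2

theorem le_lMax (L LA LB : ℝ) : L ≤ lMax L LA LB ∧ LA ≤ lMax L LA LB ∧ LB ≤ lMax L LA LB := by
  simp [lMax]

/-- The product of the time budget and the scale of the inverse step size. -/
theorem budget_mul_stepScale_le {n d m l : ℕ} [NeZero n] [NeZero d] {κ t p L LA LB : ℝ}
    (hκ : 0 < κ) (ht : 0 < t) (hm1 : 1 ≤ m) (hl1 : 1 ≤ l) (hp : p = min ((l : ℝ) / d) 1)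
    (hLA : 0 ≤ LA) (htl : t ≤ 2 * (l * κ)) (h1 : 8 * rand1Omega d ≤ n * m)
    (h4 : (d : ℝ) ^ 2 ≤ n * l ^ 2) (h5 : (d : ℝ) ^ 3 ≤ n * m * l ^ 2) :
    t * stepScale n d m l p L LA LB ≤ t * lMax L LA LB + 2 * (d * κ * LA) := by
  have hn : (0 : ℝ) < n := by exact_mod_cast NeZero.pos n
  have hn1 : (1 : ℝ) ≤ n := by exact_mod_cast NeZero.one_le
  have hd : (0 : ℝ) < d := by exact_mod_cast NeZero.pos d
  have hm : (0 : ℝ) < m := by exact_mod_cast hm1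
  have hl : (0 : ℝ) < l := by exact_mod_cast hl1
  have hω0 := Randomness.rand1Omega_nonneg d
  have hωd : rand1Omega d ≤ d := by unfold rand1Omega; linarith
  have hLm : 0 ≤ lMax L LA LB := hLA.trans (le_lMax L LA LB).2.1
  have hp0 : 0 < p := by rw [hp]; positivity
  have hX : 0 ≤ 2 * (d * κ * LA) := by positivity
  have key : rand1Omega d * rand1Omega d ≤ p * n * m * l ∧ rand1Omega d ≤ p * l * n ∧
      t * (√(rand1Omega d) * LA / √(p * l)) ≤ t * lMax L LA LB + 2 * (d * κ * LA) := by
    -- If l ≤ d then p = l/d, and the products under the roots become n m l²/d ≥ d², n l²/d ≥ d and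
    -- l²/d. Otherwise p = 1, and all three extra terms of M are at most L_max.
    rcases le_total (l : ℝ) d with hld | hld
    · have hp' : p = l / d := by rw [hp]; exact min_eq_left ((div_le_one hd).2 hld)
      refine ⟨?_, ?_, ?_⟩
      · have e : p * n * m * l = n * m * l ^ 2 / d := by rw [hp']; field_simp
        rw [e, le_div_iff₀ hd]
        calc rand1Omega d * rand1Omega d * d ≤ d * d * d := by gcongr
          _ = d ^ 3 := by ring
          _ ≤ _ := h5
      · have e : p * l * n = n * l ^ 2 / d := by rw [hp']; field_simp
        rw [e, le_div_iff₀ hd]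
        calc rand1Omega d * d ≤ d * d := by gcongr
          _ = d ^ 2 := by ring
          _ ≤ _ := h4
      · have e : p * l = l ^ 2 / d := by rw [hp']; field_simp
        have e1 : √(rand1Omega d) * LA / √(p * l) ≤ d * LA / l := by
          rw [e, Real.sqrt_div (by positivity), Real.sqrt_sq hl.le, div_div_eq_mul_div]
          gcongr ?_ / _
          calc √(rand1Omega d) * LA * √d ≤ √d * LA * √d := by gcongr
            _ = (√d * √d) * LA := by ring
            _ = d * LA := by rw [Real.mul_self_sqrt hd.le]
        -- The factor l in t ≤ 2lκ cancels the 1/l of the L_A term: this is the origin of the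
        -- separate summand d κ L_A Δ/ε.
        calc t * (√(rand1Omega d) * LA / √(p * l)) ≤ 2 * (l * κ) * (d * LA / l) := by gcongr
          _ = 2 * (d * κ * LA) := by field_simp
          _ ≤ _ := by linarith [mul_nonneg ht.le hLm]
    · have hp' : p = 1 := by rw [hp]; exact min_eq_right ((one_le_div hd).2 hld)
      refine ⟨?_, ?_, ?_⟩
      · rw [hp']
        calc rand1Omega d * rand1Omega d ≤ n * m * l := by
              gcongr
              · linarith
              · linarith
          _ = _ := by ring
      · rw [hp']
        nlinarith
      · have e := sqrt_mul_div_sqrt_le (A := rand1Omega d) (C := p * l) hLA (by positivity)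
          (by rw [hp']; linarith)
        have : t * (√(rand1Omega d) * LA / √(p * l)) ≤ t * lMax L LA LB := by
          gcongr
          exact e.trans (le_lMax L LA LB).2.1
        linarith
  have hbound : t * lMax L LA LB ≤ t * lMax L LA LB + 2 * (d * κ * LA) := by linarith
  have h2 : √(rand1Omega d * rand1Omega d) * lMax L LA LB / √(p * n * m * l) ≤ lMax L LA LB :=
    sqrt_mul_div_sqrt_le hLm (by positivity) key.1
  have h3 : √(rand1Omega d) * lMax L LA LB / √(p * l * n) ≤ lMax L LA LB :=
    sqrt_mul_div_sqrt_le hLm (by positivity) key.2.1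
  unfold stepScale
  rw [sup_eq_left.2 h2, sup_eq_left.2 h3]
  rcases le_total (lMax L LA LB) (√(rand1Omega d) * LA / √(p * l)) with hc | hc
  · rw [sup_eq_right.2 hc]; exact key.2.2
  · rw [sup_eq_left.2 hc]; exact hbound

/-- The coefficients of the Lyapunov function satisfy the requirements of the one-step bound. -/
theorem step_coefficients {n d m l : ℕ} [NeZero n] [NeZero d] {p γ L LA LB : ℝ} (hm1 : 1 ≤ m)
    (hl1 : 1 ≤ l) (hp : 0 < p) (hL : 0 ≤ L) (hLA : 0 ≤ LA) (hLB : 0 ≤ LB) (hγ : 0 < γ)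
    (hM : γ * stepScale n d m l p L LA LB ≤ 1 / 6) :
    L / 2 * γ ^ 2 + γ ^ 2 * (((γ / 2 * LA ^ 2 + γ * (rand1Omega d / (n * m)) * L ^ 2) / p) *
      (rand1Omega d / l) + (γ / 2 * LB ^ 2 / p) * (rand1Omega d / (n * l))) ≤ 5 / 36 * γ := by
  have hn : (0 : ℝ) < n := by exact_mod_cast NeZero.pos n
  have hm : (0 : ℝ) < m := by exact_mod_cast hm1
  have hl : (0 : ℝ) < l := by exact_mod_cast hl1
  have hω0 := Randomness.rand1Omega_nonneg d
  obtain ⟨hL1, -, hL3⟩ := le_lMax L LA LB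
  have hLm : 0 ≤ lMax L LA LB := hL.trans hL1
  have s1 : γ * lMax L LA LB ≤ 1 / 6 :=
    (mul_le_mul_of_nonneg_left (by simp [stepScale]) hγ.le).trans hM
  have s2 := sq_mul_div_le_of_scale (A := rand1Omega d * rand1Omega d) (B := lMax L LA LB)
    (C := p * n * m * l) (by positivity) hLm (by positivity) hγ (by simp [stepScale]) hM
  have s3 := sq_mul_div_le_of_scale (A := rand1Omega d) (B := lMax L LA LB)
    (C := p * l * n) (by positivity) hLm (by positivity) hγ (by simp [stepScale]) hM
  have s4 := sq_mul_div_le_of_scale (A := rand1Omega d) (B := LA)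
    (C := p * l) (by positivity) hLA (by positivity) hγ (by simp [stepScale]) hM
  have r1 : γ * L ≤ 1 / 6 := (by gcongr : γ * L ≤ γ * lMax L LA LB).trans s1
  have r2 : γ ^ 2 * (rand1Omega d * rand1Omega d * L ^ 2 / (p * n * m * l)) ≤ 1 / 36 :=
    le_trans (by gcongr) s2
  have r3 : γ ^ 2 * (rand1Omega d * LB ^ 2 / (p * l * n)) ≤ 1 / 36 := le_trans (by gcongr) s3
  have e : L / 2 * γ ^ 2 + γ ^ 2 * (((γ / 2 * LA ^ 2 + γ * (rand1Omega d / (n * m)) * L ^ 2) / p) *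
      (rand1Omega d / l) + (γ / 2 * LB ^ 2 / p) * (rand1Omega d / (n * l))) =
      γ * ((γ * L) / 2 + γ ^ 2 * (rand1Omega d * LA ^ 2 / (p * l)) / 2 +
        γ ^ 2 * (rand1Omega d * rand1Omega d * L ^ 2 / (p * n * m * l)) +
        γ ^ 2 * (rand1Omega d * LB ^ 2 / (p * l * n)) / 2) := by
    field_simp
    ring
  rw [e, mul_comm]
  gcongr
  -- The four terms add up to at most 1/12 + 1/72 + 1/36 + 1/72 = 5/36.
  linarith

theorem noise_bounds {n d b m : ℕ} [NeZero n] [NeZero d] {σ ε : ℝ} (hb1 : 1 ≤ b) (hm1 : 1 ≤ m)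
    (h1 : 8 * rand1Omega d ≤ n * m) (h2 : 8 * σ ^ 2 ≤ n * b * ε)
    (h3 : 8 * (d * σ ^ 2) ≤ n * m * b * ε) :
    rand1Omega d / (n * m) ≤ 1 / 8 ∧ (rand1Omega d / m + 1) * (σ ^ 2 / (n * b)) ≤ ε / 4 := by
  have hn : (0 : ℝ) < n := by exact_mod_cast NeZero.pos n
  have hb : (0 : ℝ) < b := by exact_mod_cast hb1
  have hm : (0 : ℝ) < m := by exact_mod_cast hm1
  have hωd : rand1Omega d ≤ d := by unfold rand1Omega; linarith
  refine ⟨?_, ?_⟩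
  · rw [div_le_iff₀ (by positivity)]; linarith
  · have e1 : σ ^ 2 / (n * b) ≤ ε / 8 := by
      rw [div_le_iff₀ (by positivity)]; linarith
    have e2 : rand1Omega d * σ ^ 2 / (n * m * b) ≤ ε / 8 := by
      rw [div_le_iff₀ (by positivity)]
      have := mul_le_mul_of_nonneg_right hωd (sq_nonneg σ)
      linarith
    have e3 : (rand1Omega d / m + 1) * (σ ^ 2 / (n * b)) =
        rand1Omega d * σ ^ 2 / (n * m * b) + σ ^ 2 / (n * b) := by
      field_simp
    linarith

/-! ### Stationarity of the output and the number of iterations -/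

namespace Randomness

variable {Ω : Type v} [MeasurableSpace Ω] {P : Measure Ω} [IsProbabilityMeasure P] {Ξ : Type u}
  [MeasurableSpace Ξ] {D : Measure Ξ} [IsProbabilityMeasure D] {n d b m l : ℕ} [NeZero n]
  [NeZero d] {p : ℝ} (R : Randomness P D n d b m l p) {f : Vec d → ℝ} {G : Vec d → Ξ → Vec d}
  {σ : ℝ}

/-- After `N` iterations with `4 Δ ≤ (N + 1) γ ε`, the output is `ε`-stationary. -/
theorem isEpsStationary_of_le {fstar L LA LB γ ε : ℝ} {x0 : Vec d} (hb : 1 ≤ b) (hm : 1 ≤ m)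
    (hl : 1 ≤ l) (hp : 0 < p) (hp1 : p ≤ 1) (hf : IsLSmooth f L) (hstar : ∀ x, fstar ≤ f x)
    (hfun : FunctionalInequality f LA LB) (h : IsStochasticGradient f G D σ) (hγ : 0 < γ)
    (hε : 0 < ε) (hw : rand1Omega d / (n * m) ≤ 1 / 8)
    (hS : (rand1Omega d / m + 1) * (σ ^ 2 / (n * b)) ≤ ε / 4)
    (hM : γ * stepScale n d m l p L LA LB ≤ 1 / 6) {N : ℕ}
    (hN : 4 * (f x0 - fstar) ≤ (N + 1) * (γ * ε)) :
    IsEpsStationary (P.prod (uniformFin (N + 1))) f ε (output R G γ x0 N) := by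
  have hω0 := rand1Omega_nonneg d
  -- The smallest weights for which the contraction by 1 - p of V and W pays for the gradient
  -- errors.
  set α : ℝ := (γ / 2 * LA ^ 2 + γ * (rand1Omega d / (n * m)) * L ^ 2) / p with hα
  set β : ℝ := γ / 2 * LB ^ 2 / p with hβ
  have hα0 : 0 ≤ α := by positivity
  have hβ0 : 0 ≤ β := by positivity
  have hgrad := hf.continuous_gradient
  have hstep := R.one_step (by omega) (by omega) (by omega) ⟨hp.le, hp1⟩ hf hstar hfun h hγ hα0
    hβ0 hε.le (step_coefficients hm hl hp hf.nonneg hfun.1 hfun.2.1 hγ hM) hw hS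
    (le_of_eq (by rw [hα]; field_simp)) (le_of_eq (by rw [hβ]; field_simp))
  have hFm : Measurable fun s : Vec d × (Fin n → Vec d) =>
      ENNReal.ofReal (67 / 144 * γ * ‖gradient f s.1‖ ^ 2) := by
    have : Measurable fun s : Vec d × (Fin n → Vec d) => gradient f s.1 :=
      hgrad.measurable.comp measurable_fst
    exact ((this.norm.pow_const 2).const_mul _).ennreal_ofReal
  have hsum := R.sum_le_of_step h.measurable γ x0
    (measurable_lyapunov hf.1.continuous fstar α β).ennreal_ofReal hFm hstep (N + 1)
  refine R.isEpsStationary_output h.measurable hgrad hε.le N ?_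
  have hγ0 : ENNReal.ofReal (67 / 144 * γ) ≠ 0 := by
    rw [ne_eq, ENNReal.ofReal_eq_zero, not_le]; positivity
  have h0 : lyapunov f fstar α β (x0, fun _ : Fin n => x0) = f x0 - fstar := by simp [lyapunov]
  have hΔ : 0 ≤ f x0 - fstar := by linarith [hstar x0]
  have h1 : ∀ k, ∫⁻ ω, ENNReal.ofReal (67 / 144 * γ * ‖gradient f (state R G γ x0 ω k).1‖ ^ 2) ∂P =
      ENNReal.ofReal (67 / 144 * γ) *
        ∫⁻ ω, ENNReal.ofReal (‖gradient f (state R G γ x0 ω k).1‖ ^ 2) ∂P := fun k => by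
    rw [← lintegral_const_mul' _ _ ENNReal.ofReal_ne_top]
    exact lintegral_congr fun ω => ENNReal.ofReal_mul (by positivity)
  simp only [h1] at hsum
  rw [← Finset.mul_sum, h0] at hsum
  rw [← ENNReal.mul_le_mul_iff_right hγ0 ENNReal.ofReal_ne_top]
  refine hsum.trans ?_
  rw [← ENNReal.ofReal_natCast, ← ENNReal.ofReal_mul (by positivity),
    ← ENNReal.ofReal_add hΔ (by positivity), ← ENNReal.ofReal_mul (by positivity)]
  refine ENNReal.ofReal_le_ofReal ?_
  push_cast
  have : 0 ≤ (N + 1) * (γ * ε) := by positivity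
  -- Δ is at most 36/144 of (N + 1) γ ε, the noise adds 5/144, and 41 ≤ 67.
  nlinarith

theorem isEpsStationary_zero {L fstar γ ε : ℝ} {x0 : Vec d} (hL : 0 < L) (hf : IsLSmooth f L)
    (hstar : ∀ x, fstar ≤ f x) (hG : Measurable (Function.uncurry G)) (hε : 0 ≤ ε)
    (hΔ : 2 * L * (f x0 - fstar) ≤ ε) :
    IsEpsStationary (P.prod (uniformFin (0 + 1))) f ε (output R G γ x0 0) := by
  refine R.isEpsStationary_output hG hf.continuous_gradient hε 0 ?_
  have h1 := (hf.norm_gradient_sq_le hL hstar x0).trans hΔ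
  simpa [state] using ENNReal.ofReal_le_ofReal h1

end Randomness

/-- The number of iterations times their expected duration. -/
theorem count_mul_budget_le {c t M γ ε Δ Lm S X : ℝ} {N : ℕ} (hc : 0 < c) (ht : 0 < t)
    (hγ : 0 < γ) (hε : 0 < ε) (hΔ0 : 0 ≤ Δ) (hX : 0 ≤ X)
    (hcM : c ≤ γ * M) (hLM : Lm ≤ M) (hΔ : ε < 2 * Lm * Δ)
    (hN : N = ⌈4 * Δ / (γ * ε)⌉₊) (htS : t ≤ 16 * S) (hLm : 0 ≤ Lm)
    (htM : t * M ≤ t * Lm + 2 * X) :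
    N * (4 * t) ≤ 64 * (4 / c + 2) * (S * (Lm * Δ / ε) + X * Δ / ε) := by
  have hN1 : (N : ℝ) ≤ 4 * Δ / (γ * ε) + 1 := by
    rw [hN]; exact (Nat.ceil_lt_add_one (by positivity)).le
  have h1 : 1 / γ ≤ M / c := by
    rw [div_le_div_iff₀ hγ hc]; linarith
  have h2 : 4 * Δ / (γ * ε) ≤ 4 / c * (M * Δ / ε) := by
    calc 4 * Δ / (γ * ε) = 4 * Δ / ε * (1 / γ) := by field_simp
      _ ≤ 4 * Δ / ε * (M / c) := by gcongr
      _ = _ := by field_simp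
  -- Outside the trivial case, 1 < 2 L_max Δ/ε, so the + 1 of the ceiling is absorbed into MΔ/ε.
  have h3 : 1 ≤ 2 * (M * Δ / ε) := by
    have : 1 ≤ 2 * Lm * Δ / ε := (one_le_div hε).2 hΔ.le
    calc 1 ≤ 2 * Lm * Δ / ε := this
      _ = 2 * (Lm * Δ / ε) := by ring
      _ ≤ _ := by gcongr
  have h4 : (N : ℝ) ≤ (4 / c + 2) * (M * Δ / ε) := by linarith
  calc N * (4 * t) ≤ (4 / c + 2) * (M * Δ / ε) * (4 * t) := by gcongr
    _ = 4 * (4 / c + 2) * (Δ / ε) * (t * M) := by ring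
    _ ≤ 4 * (4 / c + 2) * (Δ / ε) * (t * Lm + 2 * X) := by gcongr
    -- The coefficient of X is raised from 2 to 16 so that both summands carry the same constant 4 ·
    -- 16 = 64.
    _ ≤ 4 * (4 / c + 2) * (Δ / ε) * (16 * S * Lm + 16 * X) := by
        gcongr ?_ * (?_ * _ + ?_)
        linarith
    _ = _ := by ring

end Inkheart

end

/-! ### The complexity bound -/

theorem mainTheorem1 (c : ℝ) (hc : 0 < c) :
    ∃ C : ℝ, 0 < C ∧
      ∀ (n d : ℕ) [NeZero n] [NeZero d] (h τ κ σ ε L LA LB Δ t p γ : ℝ) (b m l : ℕ),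
        0 < h → 0 < τ → 0 < κ → 0 ≤ σ → 0 < ε →
        t = Inkheart.timeBudget n d h τ κ σ ε →
        b = ⌊t / h⌋₊ → m = ⌊t / τ⌋₊ → l = ⌊t / κ⌋₊ →
        p = min ((l : ℝ) / (d : ℝ)) 1 →
        0 < γ →
        c ≤ γ * Inkheart.stepScale n d m l p L LA LB →
        γ * Inkheart.stepScale n d m l p L LA LB ≤ 1 / 6 →
        ∃ N : ℕ,
          ∀ (f : Inkheart.Vec d → ℝ) (fstar : ℝ) (x0 : Inkheart.Vec d),
            Inkheart.IsLSmooth f L →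
            (∀ x, fstar ≤ f x) →
            Δ = f x0 - fstar →
            Inkheart.FunctionalInequality f LA LB →
            ∀ (Ξ : Type u) [MeasurableSpace Ξ] (D : Measure Ξ) [IsProbabilityMeasure D]
              (G : Inkheart.Vec d → Ξ → Inkheart.Vec d),
              Inkheart.IsStochasticGradient f G D σ →
              ∀ (Ω : Type v) [MeasurableSpace Ω] (P : Measure Ω) [IsProbabilityMeasure P]
                (R : Inkheart.Randomness P D n d b m l p)
                (T : Inkheart.Timing Ω n d b m l h τ κ),
                Inkheart.IsEpsStationary (P.prod (Inkheart.uniformFin (N + 1))) f ε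
                    (Inkheart.output R G γ x0 N) ∧
                  Integrable (Inkheart.totalTime R T N) P ∧
                  ∫ ω, Inkheart.totalTime R T N ω ∂P ≤
                    C * Inkheart.timeRate n d h τ κ σ ε L LA LB Δ := by
  open Inkheart in
  refine ⟨64 * (4 / c + 2), by positivity, ?_⟩
  intro n d _ _ h τ κ σ ε L LA LB Δ t p γ b m l hh hτ hκ _ hε ht hb hm hl hp hγ hcM hM
  have hd : (0 : ℝ) < d := by exact_mod_cast NeZero.pos d
  have t1 : h ≤ t := by simp [ht, timeBudget]
  have t2 : τ ≤ t := by simp [ht, timeBudget]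
  have t3 : κ ≤ t := by simp [ht, timeBudget]
  have t0 : 0 < t := hh.trans_le t1
  obtain ⟨b1, b2, -⟩ := floor_div_bounds hh t1 hb
  obtain ⟨m1, m2, -⟩ := floor_div_bounds hτ t2 hm
  obtain ⟨l1, l2, l3⟩ := floor_div_bounds hκ t3 hl
  obtain ⟨q1, q2, q3, q4, q5⟩ := budget_bounds hh hτ hκ hε ht hb hm hl
  obtain ⟨hw, hS⟩ := noise_bounds b1 m1 q1 q2 q3
  have hl0 : (0 : ℝ) < l := by exact_mod_cast l1
  have hp0 : 0 < p := by rw [hp]; positivity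
  have hp1 : p ≤ 1 := by rw [hp]; exact min_le_right _ _
  -- The choice p ≤ l/d makes the expected cost of synchronization at most that of the l compressed
  -- messages; an iteration then takes at most 4t in expectation.
  have hpd : d * κ * p ≤ t := by
    have h1 : p ≤ l / d := by rw [hp]; exact min_le_left _ _
    calc d * κ * p ≤ d * κ * (l / d) := by gcongr
      _ = l * κ := by field_simp
      _ ≤ t := l2
  have hM0 : 0 < stepScale n d m l p L LA LB := by
    by_contra hcon
    have := mul_nonpos_of_nonneg_of_nonpos hγ.le (not_lt.1 hcon)
    linarith
  have hLM : lMax L LA LB ≤ stepScale n d m l p L LA LB := by simp [stepScale]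
  have hS0 : 0 ≤ timeScale n d h τ κ σ ε := hh.le.trans (by simp [timeScale])
  have htS : t ≤ 16 * timeScale n d h τ κ σ ε := ht ▸ timeBudget_le hh hτ hκ
  -- N is fixed before f is given, and the sign of L_A is known only through f; hence the
  -- implication.
  have htM : 0 ≤ LA → t * stepScale n d m l p L LA LB ≤ t * lMax L LA LB + 2 * (d * κ * LA) :=
    fun hLA => budget_mul_stepScale_le hκ t0 m1 l1 hp hLA l3 q1 q4 q5
  by_cases hΔ : 2 * lMax L LA LB * Δ ≤ ε
  · refine ⟨0, ?_⟩
    intro f fstar x0 hf hstar hΔe hfun Ξ _ D _ G hG Ω _ P _ R T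
    have hLA := hfun.1
    have hLm0 : 0 ≤ lMax L LA LB := hLA.trans (le_lMax L LA LB).2.1
    have hΔ0 : 0 ≤ Δ := by linarith [hstar x0]
    -- If L_max were 0, then so would be L_A and every term of M, contrary to c ≤ γ M.
    have hLm : 0 < lMax L LA LB := by
      refine hLm0.lt_of_ne fun h0 => ?_
      have hLA0 : LA = 0 := le_antisymm (h0 ▸ (le_lMax L LA LB).2.1) hLA
      rw [stepScale, ← h0, hLA0] at hM0
      simp at hM0
    obtain ⟨hi, htime⟩ := R.totalTime_bound ⟨hp0.le, hp1⟩ hκ.le T 0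
    refine ⟨R.isEpsStationary_zero hLm (hf.mono (le_lMax L LA LB).1) hstar hG.measurable hε.le
      (hΔe ▸ hΔ), hi, htime.trans ?_⟩
    rw [timeRate_eq, Nat.cast_zero, zero_mul]
    positivity
  · refine ⟨⌈4 * Δ / (γ * ε)⌉₊, ?_⟩
    intro f fstar x0 hf hstar hΔe hfun Ξ _ D _ G hG Ω _ P _ R T
    have hLA := hfun.1
    have hLm0 : 0 ≤ lMax L LA LB := hLA.trans (le_lMax L LA LB).2.1
    have hΔ0 : 0 ≤ Δ := by linarith [hstar x0]
    obtain ⟨hi, htime⟩ := R.totalTime_bound ⟨hp0.le, hp1⟩ hκ.le T ⌈4 * Δ / (γ * ε)⌉₊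
    refine ⟨R.isEpsStationary_of_le b1 m1 l1 hp0 hp1 hf hstar hfun hG hγ hε hw hS hM ?_, hi,
      htime.trans ?_⟩
    · rw [← hΔe]
      have h1 := (div_le_iff₀ (by positivity)).1 (Nat.le_ceil (4 * Δ / (γ * ε)))
      have h2 : 0 < γ * ε := by positivity
      linarith
    · rw [timeRate_eq]
      refine le_trans ?_ (count_mul_budget_le hc t0 hγ hε hΔ0 (by positivity) hcM hLM
        (not_le.1 hΔ) rfl htS hLm0 (htM hLA))
      gcongr
      linarith
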